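/- Let $d\ge 2$ be an integer and $0<s<\frac d2$. For $\varphi\in C_c^\infty(\mathbb R^d)$ let $(-\Delta)^s\varphi=\mathscr F^{-1}\big[|\cdot|^{2s}\mathscr F[\varphi]\big]$, where $\mathscr F$ is the Fourier transform $\mathscr F[\varphi](\xi)=\int_{\mathbb R^d}e^{-ix\cdot\xi}\varphi(x)\,dx$, and write $B_r=\{x\in\mathbb R^d:|x|<r\}$. Then for every multi-index $n\in\mathbb N^d$ there is a constant $C=C(d,s,n)>0$ such that the following holds for all $R>0$. Let $k\in\mathbb N$, $p_1,\dots,p_k\in[1,\infty)$, $u_i\in L^{p_i}(\mathbb R^d)$ real-valued and $u=\sum_{i=1}^k u_i$ a.e. Suppose that $u$ is $s$-harmonic in $B_{2R}$, that is, $(-\Delta)^s u=0$ in $\mathscr D'(B_{2R})$: $$\int_{\mathbb R^d}u(x)\,(-\Delta)^s\varphi(x)\,dx=0\qquad\text{for all }\varphi\in C_c^\infty(B_{2R}).$$ Then $u\in C^\infty(\overline{B_R})$, i.e. $u$ coincides a.e. on $\overline{B_R}$ with the restriction of a $C^\infty$ function on $\mathbb R^d$, and, with $D^nu$ computed from this smooth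 representative, for every multi-index $n\in\mathbb N^d$ $$\|D^n u\|_{L^\infty(\overline{B_R})}\le C(d,s,n)\sum_{i=1}^k R^{-|n|-\frac d{p_i}}\,\|u_i\|_{L^{p_i}(\mathbb R^d)}.$$ -/

import Mathlib

open MeasureTheory
open scoped FourierTransform ContDiff

noncomputable section

/-- The fractional Laplacian `(-Δ)^s φ = 𝓕⁻¹[|ξ|^{2s} 𝓕 φ]` of a test function `φ` on `ℝ^d`.
Mathlib's Fourier transform has kernel `exp (-2π i ⟪x, ξ⟫)`, so the symbol `|ξ|^{2s}` of the
normalization with kernel `exp (-i ⟪x, ξ⟫)` becomes `(2π|ξ|)^{2s}`. The value is a complex number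
that happens to be real, since `φ` is real and the symbol is real and even. -/
def fracLaplacian {d : ℕ} (s : ℝ) (φ : EuclideanSpace ℝ (Fin d) → ℝ) :
    EuclideanSpace ℝ (Fin d) → ℂ :=
  𝓕⁻ (fun ξ : EuclideanSpace ℝ (Fin d) =>
    (((2 * Real.pi * ‖ξ‖) ^ (2 * s) : ℝ) : ℂ) *
      𝓕 (fun x : EuclideanSpace ℝ (Fin d) => (φ x : ℂ)) ξ)

/-- `(-Δ)^s u = 0` in `𝒟'(Ω)`: the distribution `φ ↦ ∫ u (-Δ)^s φ` vanishes on all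
`φ ∈ C_c^∞(Ω)`. Meaningful for every locally integrable `u` with
`∫ |u(x)| / (1 + |x|)^{d+2s} dx < ∞`, in particular for finite sums of `L^p` functions, because
`(-Δ)^s φ` is continuous and `O((1 + |x|)^{-d-2s})`, so that the integrand is then integrable. -/
def IsFracHarmonicOn {d : ℕ} (s : ℝ) (u : EuclideanSpace ℝ (Fin d) → ℝ)
    (Ω : Set (EuclideanSpace ℝ (Fin d))) : Prop :=
  ∀ φ : EuclideanSpace ℝ (Fin d) → ℝ, ContDiff ℝ ∞ φ → HasCompactSupport φ → tsupport φ ⊆ Ω →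
    ∫ x, (u x : ℂ) * fracLaplacian s φ x = 0

/-- The partial derivative `∂_i f`. -/
def partialDeriv {d : ℕ} (i : Fin d) (f : EuclideanSpace ℝ (Fin d) → ℝ) :
    EuclideanSpace ℝ (Fin d) → ℝ :=
  fun x => fderiv ℝ f x (EuclideanSpace.single i 1)

/-- The partial derivative `D^n f = ∂_0^{n_0} ∂_1^{n_1} ⋯ ∂_{d-1}^{n_{d-1}} f` for a multi-index
`n ∈ ℕ^d`. -/
def multiDeriv {d : ℕ} (n : Fin d → ℕ) (f : EuclideanSpace ℝ (Fin d) → ℝ) :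
    EuclideanSpace ℝ (Fin d) → ℝ :=
  (List.finRange d).foldr (fun i g => (partialDeriv i)^[n i] g) f

end

/-! The proof constructs a smooth kernel that reproduces `s`-harmonic functions, so that interior
regularity and the estimates are read off a convolution. Let η (`bumpSq`) be a radial test function
supported in the unit ball with nonnegative Fourier transform, let θ = (-Δ)^s η, and let ρ(x) = ∫₀¹
λ^(d-1) θ(λx) dλ (`parametrix`). Then N^d ρ(Nz) = ∫₀^N t^(d-1) θ(tz) dt, so the N-derivative of the
dilated kernel is N^(d-1) θ(Nz). By homogeneity θ(t(x - y)) is t^(-2s) times the fractional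
Laplacian in y of η(t(x - y)), a test function supported within distance 1/t of x. Hence, if `u` is
`s`-harmonic in B_{2R} and |x| < 3R/2, the convolution of `u` with N^d ρ(N·) at x does not depend on
N ≥ 2/R (`integral_mul_comp_smul_sub_diff`, `integral_mul_fracLap_bumpSq_eq_zero`). As N → ∞ it
tends to (∫ρ) u in the sense of distributions (`tendsto_integral_mul_integral_dilate`). Therefore u
= (∫ρ)⁻¹ u * ρ_N almost everywhere there, with N = 2/R (`ae_eq_weightConv_reproKernel`). Derivatives
fall on the kernel, and Hölder's inequality with scaling gives the powers of R
(`abs_integral_mul_reproKernel_le`).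

Two properties of ρ carry the argument. The first is the decay of ρ and all its derivatives at rate
-(d + δ), for some 0 < δ < 1 with δ ≤ 2s (`smoothDecay_parametrix`). It rests on the decay of θ,
obtained from a hypersingular integral formula for (-Δ)^s with differences of order m > s
(`exists_abs_fracLap_le`), and on the cancellation ∫θ = 0. The second is ∫ρ > 0
(`integral_parametrix_pos`): along rays the Fourier transform of ρ is nonincreasing because that of
θ is nonnegative, it vanishes at infinity, and it drops strictly near the origin. -/

/-! ### Test functions and their Fourier transforms -/

/-- Test functions: smooth and compactly supported. -/
structure IsTest {d : ℕ} (f : EuclideanSpace ℝ (Fin d) → ℝ) : Prop where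
  contDiff : ContDiff ℝ ∞ f
  hasCompactSupport : HasCompactSupport f

namespace IsTest

variable {d : ℕ} {f : EuclideanSpace ℝ (Fin d) → ℝ}

/-- The complex-valued Schwartz function attached to a test function. -/
noncomputable def schwartz (hf : IsTest f) : SchwartzMap (EuclideanSpace ℝ (Fin d)) ℂ :=
  HasCompactSupport.toSchwartzMap (f := fun x => (f x : ℂ))
    (hf.hasCompactSupport.comp_left (g := fun r : ℝ => (r : ℂ)) (by simp))
    (Complex.ofRealCLM.contDiff.comp hf.contDiff)

lemma coe_schwartz (hf : IsTest f) : (hf.schwartz : EuclideanSpace ℝ (Fin d) → ℂ) =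
    fun x => (f x : ℂ) := rfl

lemma coe_fourier_schwartz (hf : IsTest f) :
    (𝓕 hf.schwartz : SchwartzMap (EuclideanSpace ℝ (Fin d)) ℂ) = 𝓕 (fun x => (f x : ℂ)) := by
  rw [SchwartzMap.fourier_coe, hf.coe_schwartz]

lemma continuous_fourier (hf : IsTest f) : Continuous (𝓕 (fun x => (f x : ℂ))) := by
  rw [← hf.coe_fourier_schwartz]; exact (𝓕 hf.schwartz).continuous

lemma integrable_pow_mul_fourier (hf : IsTest f) (k : ℕ) :
    Integrable (fun ξ => ‖ξ‖ ^ k * ‖𝓕 (fun x => (f x : ℂ)) ξ‖) := by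
  rw [← hf.coe_fourier_schwartz]; exact (𝓕 hf.schwartz).integrable_pow_mul volume k

lemma integrable_fourier (hf : IsTest f) : Integrable (𝓕 (fun x => (f x : ℂ))) := by
  rw [← hf.coe_fourier_schwartz]; exact (𝓕 hf.schwartz).integrable

lemma integrable_rpow_mul_fourier (hf : IsTest f) {a : ℝ} (ha : 0 ≤ a) :
    Integrable (fun ξ => ‖ξ‖ ^ a * ‖𝓕 (fun x => (f x : ℂ)) ξ‖) := by
  -- A real power is dominated by the sum of two natural ones: |ξ|^a ≤ 1 + |ξ|^⌈a⌉.
  refine ((hf.integrable_pow_mul_fourier 0).add (hf.integrable_pow_mul_fourier ⌈a⌉₊)).mono' ?_ ?_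
  · exact ((continuous_norm.rpow_const fun _ => Or.inr ha).mul
      hf.continuous_fourier.norm).aestronglyMeasurable
  · filter_upwards with ξ
    rw [Real.norm_of_nonneg (by positivity)]
    simp only [Pi.add_apply, ← add_mul]
    gcongr
    rcases le_total ‖ξ‖ 1 with h | h
    · have := Real.rpow_le_one (norm_nonneg ξ) h ha
      have : 0 ≤ ‖ξ‖ ^ ⌈a⌉₊ := by positivity
      simp; linarith
    · have := Real.rpow_le_rpow_of_exponent_le h (Nat.le_ceil a)
      rw [Real.rpow_natCast] at this
      simp; linarith

lemma fourier_inversion (hf : IsTest f) (x : EuclideanSpace ℝ (Fin d)) :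
    (f x : ℂ) = ∫ ξ, Complex.exp (2 * Real.pi * inner ℝ ξ x * Complex.I) *
      𝓕 (fun x => (f x : ℂ)) ξ := by
  have h := Continuous.fourierInv_fourier_eq (f := fun x => (f x : ℂ))
    (Complex.continuous_ofReal.comp hf.contDiff.continuous) hf.schwartz.integrable
    hf.integrable_fourier
  have h2 := congrFun h x
  rw [Real.fourierInv_eq'] at h2
  rw [← h2]
  simp

lemma fracLaplacian_eq (s : ℝ) (f : EuclideanSpace ℝ (Fin d) → ℝ) (x : EuclideanSpace ℝ (Fin d)) :
    fracLaplacian s f x = ∫ ξ, Complex.exp (2 * Real.pi * inner ℝ ξ x * Complex.I) *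
      ((((2 * Real.pi * ‖ξ‖) ^ (2 * s) : ℝ) : ℂ) * 𝓕 (fun x => (f x : ℂ)) ξ) := by
  rw [fracLaplacian, Real.fourierInv_eq']
  simp

end IsTest

/-! ### Iterated symmetric differences -/

/-- The symmetric second difference `2 f(x) - f(x+h) - f(x-h)`. -/
def symDiff₂ {d : ℕ} (h : EuclideanSpace ℝ (Fin d)) (f : EuclideanSpace ℝ (Fin d) → ℝ) :
    EuclideanSpace ℝ (Fin d) → ℝ :=
  fun x => 2 * f x - f (x + h) - f (x - h)

section symDiff

variable {d : ℕ}

/-- Each difference has coefficients of total size 2 + 1 + 1 = 4 and widens the range of sampled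
points by one step. Keeping the sample points explicit shows, in the decay estimate, which `h` can
contribute far from the support. -/
lemma abs_symDiff₂_iterate_le (m : ℕ) (h : EuclideanSpace ℝ (Fin d))
    (f : EuclideanSpace ℝ (Fin d) → ℝ) (x : EuclideanSpace ℝ (Fin d)) :
    |(symDiff₂ h)^[m] f x| ≤ 4 ^ m * ∑ j ∈ Finset.Icc (-m : ℤ) m, |f (x + j • h)| := by
  induction m generalizing x with
  | zero => simp
  | succ m ih =>
    rw [Function.iterate_succ_apply', symDiff₂]
    have key : ∀ i : ℤ, |i| ≤ 1 → |(symDiff₂ h)^[m] f (x + i • h)| ≤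
        4 ^ m * ∑ j ∈ Finset.Icc (-(m + 1 : ℕ) : ℤ) (m + 1 : ℕ), |f (x + j • h)| := by
      intro i hi
      refine (ih _).trans ?_
      gcongr 4 ^ m * ?_
      have : ∑ j ∈ Finset.Icc (-m : ℤ) m, |f (x + i • h + j • h)| =
          ∑ j ∈ (Finset.Icc (-m : ℤ) m).map (addLeftEmbedding i), |f (x + j • h)| := by
        rw [Finset.sum_map]
        simp [add_smul, add_assoc]
      rw [this]
      refine Finset.sum_le_sum_of_subset_of_nonneg ?_ fun _ _ _ => abs_nonneg _
      intro j hj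
      simp only [Finset.mem_map, Finset.mem_Icc, addLeftEmbedding_apply] at hj ⊢
      obtain ⟨k, hk, rfl⟩ := hj
      rw [abs_le] at hi
      push_cast
      constructor <;> linarith [hi.1, hi.2, hk.1, hk.2]
    have h0 := key 0 (by simp)
    have h1 := key 1 (by simp)
    have h2 := key (-1) (by simp)
    simp only [zero_smul, add_zero, one_smul, neg_smul, ← sub_eq_add_neg] at h0 h1 h2
    rw [pow_succ]
    rw [abs_le] at *
    constructor <;> linarith [h0.1, h0.2, h1.1, h1.2, h2.1, h2.2]

lemma symDiff₂_iterate_affine (m : ℕ) (h a : EuclideanSpace ℝ (Fin d)) (t : ℝ)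
    (f : EuclideanSpace ℝ (Fin d) → ℝ) (x : EuclideanSpace ℝ (Fin d)) :
    (symDiff₂ h)^[m] (fun y => f (t • (a - y))) x = (symDiff₂ (-t • h))^[m] f (t • (a - x)) := by
  induction m generalizing x with
  | zero => simp
  | succ m ih =>
    simp only [Function.iterate_succ_apply', symDiff₂, ih]
    rw [show t • (a - (x + h)) = t • (a - x) + -t • h by module,
      show t • (a - (x - h)) = t • (a - x) - -t • h by module]

lemma symDiff₂_iterate_comp_isometry (m : ℕ) (h : EuclideanSpace ℝ (Fin d))
    (A : EuclideanSpace ℝ (Fin d) ≃ₗᵢ[ℝ] EuclideanSpace ℝ (Fin d))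
    (f : EuclideanSpace ℝ (Fin d) → ℝ) (x : EuclideanSpace ℝ (Fin d)) :
    (symDiff₂ h)^[m] (fun y => f (A y)) x = (symDiff₂ (A h))^[m] f (A x) := by
  induction m generalizing x with
  | zero => simp
  | succ m ih =>
    simp only [Function.iterate_succ_apply', symDiff₂, ih, map_add, map_sub]

/-- Translation by ±h multiplies the Fourier transform by exp(±2πi ξ·h), so each second difference
contributes the multiplier 2 - 2 cos(2π ξ·h). -/
lemma symDiff₂_iterate_eq_integral (m : ℕ) {f : EuclideanSpace ℝ (Fin d) → ℝ} (hf : IsTest f)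
    (h x : EuclideanSpace ℝ (Fin d)) :
    ((symDiff₂ h)^[m] f x : ℂ) = ∫ ξ, Complex.exp (2 * Real.pi * inner ℝ ξ x * Complex.I) *
      (((2 - 2 * Real.cos (2 * Real.pi * inner ℝ ξ h)) ^ m : ℝ) *
      𝓕 (fun x => (f x : ℂ)) ξ) := by
  have hint : ∀ (m : ℕ) (x : EuclideanSpace ℝ (Fin d)), Integrable (fun ξ =>
      Complex.exp (2 * Real.pi * inner ℝ ξ x * Complex.I) *
      (((2 - 2 * Real.cos (2 * Real.pi * inner ℝ ξ h)) ^ m : ℝ) *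
      𝓕 (fun x => (f x : ℂ)) ξ)) := by
    intro m x
    refine (hf.integrable_fourier.norm.const_mul (4 ^ m)).mono' ?_ ?_
    · have := hf.continuous_fourier
      exact Continuous.aestronglyMeasurable (by fun_prop)
    · filter_upwards with ξ
      rw [norm_mul, norm_mul]
      have : (2 * (Real.pi : ℂ) * (inner ℝ ξ x : ℝ) * Complex.I) =
        ((2 * Real.pi * inner ℝ ξ x : ℝ) : ℂ) * Complex.I := by push_cast; ring
      rw [this, Complex.norm_exp_ofReal_mul_I, one_mul, Complex.norm_real, norm_pow]
      gcongr
      rw [Real.norm_eq_abs, abs_le]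
      constructor <;> linarith [Real.cos_le_one (2 * Real.pi * inner ℝ ξ h),
        Real.neg_one_le_cos (2 * Real.pi * inner ℝ ξ h)]
  induction m generalizing x with
  | zero => simpa using hf.fourier_inversion x
  | succ m ih =>
    simp only [Function.iterate_succ_apply', symDiff₂]
    push_cast
    rw [ih, ih, ih, ← integral_const_mul, ← integral_sub ((hint m x).const_mul 2) (hint m _),
      ← integral_sub _ (hint m _)]
    swap
    · exact ((hint m x).const_mul 2).sub (hint m _)
    congr 1 with ξ
    simp only [inner_add_right, inner_sub_right, Complex.ofReal_add, Complex.ofReal_sub,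
      mul_add, mul_sub, add_mul, sub_mul, Complex.exp_add, Complex.exp_sub, pow_succ]
    have hcos : (Complex.cos (2 * Real.pi * inner ℝ ξ h)) =
      (Complex.exp (2 * Real.pi * inner ℝ ξ h * Complex.I) +
        (Complex.exp (2 * Real.pi * inner ℝ ξ h * Complex.I))⁻¹) / 2 := by
      rw [Complex.cos, ← Complex.exp_neg]; simp only [neg_mul]
    push_cast
    rw [hcos]
    ring

end symDiff

/-! ### The hypersingular integral formula -/

section Hypersingular

variable {d : ℕ}

/-- In polar coordinates the integrand is r^(-1-2s) at infinity and r^(2(m-s)-1) near 0. The second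
is integrable exactly because m > s, which is why differences of high order are needed when s ≥ 1.
-/
lemma integrable_norm_rpow_mul_min [NeZero d] {s : ℝ} (hs : 0 < s) {m : ℕ} (hm : s < m) :
    Integrable (fun h : EuclideanSpace ℝ (Fin d) =>
      ‖h‖ ^ (-(d + 2 * s)) * min 1 (‖h‖ ^ (2 * m))) := by
  have hd : 1 ≤ d := NeZero.one_le
  rw [integrable_fun_norm_addHaar (μ := volume)
    (f := fun r : ℝ => r ^ (-(d + 2 * s)) * min 1 (r ^ (2 * m)))]
  rw [finrank_euclideanSpace_fin, ← Set.Ioc_union_Ioi_eq_Ioi zero_le_one]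
  have key : ∀ y : ℝ, 0 < y → y ^ (d - 1) * y ^ (-(d + 2 * s)) = y ^ (-1 - 2 * s) := by
    intro y hy
    rw [← Real.rpow_natCast, ← Real.rpow_add hy]
    congr 1
    push_cast [hd]; ring
  have hmeas : Measurable (fun y : ℝ => y ^ (d - 1) • (y ^ (-(d + 2 * s)) * min 1 (y ^ (2 * m)))) := by
    fun_prop
  refine IntegrableOn.union ?_ ?_
  · have h1 : IntegrableOn (fun y : ℝ => y ^ (2 * (m - s) - 1)) (Set.Ioc 0 1) := by
      rw [← intervalIntegrable_iff_integrableOn_Ioc_of_le zero_le_one]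
      exact intervalIntegral.intervalIntegrable_rpow' (by linarith)
    refine h1.mono' hmeas.aestronglyMeasurable ?_
    filter_upwards [ae_restrict_mem measurableSet_Ioc] with y hy
    rw [smul_eq_mul, ← mul_assoc, key y hy.1, Real.norm_of_nonneg
      (mul_nonneg (Real.rpow_nonneg hy.1.le _) (le_min zero_le_one (pow_nonneg hy.1.le _)))]
    calc y ^ (-1 - 2 * s) * min 1 (y ^ (2 * m)) ≤ y ^ (-1 - 2 * s) * y ^ (2 * m) := by
          gcongr
          · exact Real.rpow_nonneg hy.1.le _
          · exact min_le_right _ _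
      _ = y ^ (2 * (m - s) - 1) := by
          rw [← Real.rpow_natCast, ← Real.rpow_add hy.1]; congr 1; push_cast; ring
  · have h1 : IntegrableOn (fun y : ℝ => y ^ (-1 - 2 * s)) (Set.Ioi 1) :=
      integrableOn_Ioi_rpow_of_lt (by linarith) one_pos
    refine h1.mono' hmeas.aestronglyMeasurable ?_
    filter_upwards [ae_restrict_mem measurableSet_Ioi] with y hy
    have hy0 : (0 : ℝ) < y := zero_lt_one.trans hy
    rw [smul_eq_mul, ← mul_assoc, key y hy0, Real.norm_of_nonneg
      (mul_nonneg (Real.rpow_nonneg hy0.le _) (le_min zero_le_one (pow_nonneg hy0.le _)))]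
    exact mul_le_of_le_one_right (Real.rpow_nonneg hy0.le _) (min_le_left _ _)

lemma two_sub_two_cos_nonneg (t : ℝ) : 0 ≤ 2 - 2 * Real.cos t := by
  linarith [Real.cos_le_one t]

/-- The inequalities 2 - 2 cos t ≤ 4 and 2 - 2 cos t ≤ t² control large and small `h` respectively.
-/
lemma integrable_hyperSymbol [NeZero d] {s : ℝ} (hs : 0 < s) {m : ℕ} (hm : s < m)
    (ξ : EuclideanSpace ℝ (Fin d)) :
    Integrable (fun h : EuclideanSpace ℝ (Fin d) =>
      ‖h‖ ^ (-(d + 2 * s)) * (2 - 2 * Real.cos (2 * Real.pi * inner ℝ ξ h)) ^ m) := by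
  refine ((integrable_norm_rpow_mul_min hs hm).const_mul
    (4 ^ m + (2 * Real.pi * ‖ξ‖) ^ (2 * m))).mono' ?_ ?_
  · exact Measurable.aestronglyMeasurable (by fun_prop)
  · filter_upwards with h
    set t := 2 * Real.pi * inner ℝ ξ h
    have h0 := two_sub_two_cos_nonneg t
    rw [Real.norm_of_nonneg (by positivity), mul_left_comm]
    gcongr
    have h4 : (2 - 2 * Real.cos t) ^ m ≤ 4 ^ m := by
      gcongr; linarith [Real.neg_one_le_cos t]
    have h5 : (2 - 2 * Real.cos t) ^ m ≤ (2 * Real.pi * ‖ξ‖) ^ (2 * m) * ‖h‖ ^ (2 * m) := by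
      rw [← mul_pow, pow_mul]
      gcongr
      calc 2 - 2 * Real.cos t ≤ t ^ 2 := by linarith [Real.one_sub_sq_div_two_le_cos (x := t)]
        _ ≤ _ := by
          rw [sq_le_sq, abs_mul, abs_of_pos Real.two_pi_pos, mul_assoc (2 * Real.pi), abs_mul,
            abs_of_pos Real.two_pi_pos, abs_mul, abs_norm, abs_norm]
          gcongr
          exact abs_real_inner_le_norm ξ h
    have hp : 0 ≤ (2 * Real.pi * ‖ξ‖) ^ (2 * m) := by positivity
    rcases le_total 1 (‖h‖ ^ (2 * m)) with hh | hh
    · rw [min_eq_left hh]; linarith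
    · rw [min_eq_right hh, add_mul]
      have : (0 : ℝ) ≤ 4 ^ m * ‖h‖ ^ (2 * m) := by positivity
      linarith

lemma exists_linearIsometryEquiv_map_eq {x y : EuclideanSpace ℝ (Fin d)} (h : ‖x‖ = ‖y‖) :
    ∃ A : EuclideanSpace ℝ (Fin d) ≃ₗᵢ[ℝ] EuclideanSpace ℝ (Fin d), A x = y :=
  ⟨_, Submodule.reflection_sub h⟩

/-- As a function of ξ the integral is rotation invariant and, by the substitution h ↦ th,
homogeneous of degree 2s. These two properties determine it up to its value at one unit vector. -/
lemma exists_hyperSymbol_eq [NeZero d] {s : ℝ} (hs : 0 < s) {m : ℕ} (hm : s < m) :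
    ∃ κ : ℝ, 0 < κ ∧ ∀ ξ : EuclideanSpace ℝ (Fin d),
      ∫ h : EuclideanSpace ℝ (Fin d),
        ‖h‖ ^ (-(d + 2 * s)) * (2 - 2 * Real.cos (2 * Real.pi * inner ℝ ξ h)) ^ m =
      κ * (2 * Real.pi * ‖ξ‖) ^ (2 * s) := by
  have hm0 : m ≠ 0 := by rintro rfl; simp at hm; linarith
  set S : EuclideanSpace ℝ (Fin d) → ℝ := fun ξ => ∫ h : EuclideanSpace ℝ (Fin d),
        ‖h‖ ^ (-(d + 2 * s)) * (2 - 2 * Real.cos (2 * Real.pi * inner ℝ ξ h)) ^ m with hS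
  have hiso : ∀ ξ η : EuclideanSpace ℝ (Fin d), ‖ξ‖ = ‖η‖ → S ξ = S η := by
    intro ξ η h
    obtain ⟨A, rfl⟩ := exists_linearIsometryEquiv_map_eq h
    have := A.measurePreserving.integral_comp A.toHomeomorph.measurableEmbedding
      (fun h => ‖h‖ ^ (-(d + 2 * s)) * (2 - 2 * Real.cos (2 * Real.pi * inner ℝ (A ξ) h)) ^ m)
    simp only [hS]
    rw [← this]
    simp only [LinearIsometryEquiv.norm_map, LinearIsometryEquiv.inner_map_map]
  have hscale : ∀ (t : ℝ), 0 < t → ∀ ξ, S (t • ξ) = t ^ (2 * s) * S ξ := by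
    intro t ht ξ
    have := Measure.integral_comp_smul_of_nonneg (μ := (volume : Measure (EuclideanSpace ℝ (Fin d))))
      (fun h => ‖h‖ ^ (-(d + 2 * s)) * (2 - 2 * Real.cos (2 * Real.pi * inner ℝ ξ h)) ^ m) t
      (hR := ht.le)
    rw [finrank_euclideanSpace_fin] at this
    simp only [norm_smul, Real.norm_of_nonneg ht.le, Real.mul_rpow ht.le (norm_nonneg _),
      mul_assoc, smul_eq_mul, inner_smul_right] at this
    rw [integral_const_mul] at this
    simp only [hS, inner_smul_left, mul_assoc]
    simp only [RCLike.conj_to_real]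
    have h2 : (∫ h : EuclideanSpace ℝ (Fin d), ‖h‖ ^ (-(d + 2 * s)) *
        (2 - 2 * Real.cos (2 * (Real.pi * (t * inner ℝ ξ h)))) ^ m) =
        t ^ (d + 2 * s) * (t ^ (-(d + 2 * s)) * (∫ h : EuclideanSpace ℝ (Fin d), ‖h‖ ^ (-(d + 2 * s)) *
        (2 - 2 * Real.cos (2 * (Real.pi * (t * inner ℝ ξ h)))) ^ m)) := by
      rw [← mul_assoc, ← Real.rpow_add ht]; simp
    rw [h2, this, ← mul_assoc]
    congr 1
    rw [← Real.rpow_natCast, ← Real.rpow_neg ht.le, ← Real.rpow_add ht]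
    congr 1; ring
  obtain ⟨e, hne⟩ : ∃ e : EuclideanSpace ℝ (Fin d), ‖e‖ = 1 :=
    ⟨EuclideanSpace.single 0 1, by simp⟩
  refine ⟨S e / (2 * Real.pi) ^ (2 * s), ?_, ?_⟩
  · have : 0 < S e := by
      have hnn : 0 ≤ fun h : EuclideanSpace ℝ (Fin d) =>
          ‖h‖ ^ (-(d + 2 * s)) * (2 - 2 * Real.cos (2 * Real.pi * inner ℝ e h)) ^ m := by
        intro h
        have := two_sub_two_cos_nonneg (2 * Real.pi * inner ℝ e h)
        positivity
      rw [hS, integral_pos_iff_support_of_nonneg hnn (integrable_hyperSymbol hs hm e)]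
      set U : Set (EuclideanSpace ℝ (Fin d)) := {h | Real.cos (2 * Real.pi * inner ℝ e h) < 0}
      have hU : IsOpen U := isOpen_lt (by fun_prop) continuous_const
      -- At h = e/2 the cosine equals cos π = -1, so the integrand is positive on a nonempty open
      -- set.
      have hUne : U.Nonempty := by
        refine ⟨(1 / 2 : ℝ) • e, ?_⟩
        simp only [U, Set.mem_ofPred_eq, inner_smul_right, real_inner_self_eq_norm_sq, hne]
        have : 2 * Real.pi * (1 / 2 * 1 ^ 2) = Real.pi := by ring
        rw [this, Real.cos_pi]; norm_num
      refine (hU.measure_pos volume hUne).trans_le (measure_mono ?_)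
      intro h hh
      simp only [U, Set.mem_ofPred_eq] at hh
      have h0 : h ≠ 0 := by rintro rfl; simp at hh; linarith
      have : 0 < ‖h‖ ^ (-(d + 2 * s)) := Real.rpow_pos_of_pos (norm_pos_iff.mpr h0) _
      have h2 : 0 < 2 - 2 * Real.cos (2 * Real.pi * inner ℝ e h) := by linarith
      rw [Function.mem_support]
      positivity
    exact div_pos this (Real.rpow_pos_of_pos Real.two_pi_pos _)
  · intro ξ
    change S ξ = _
    rcases eq_or_ne ξ 0 with rfl | hξ
    · simp [hS, hm0, Real.zero_rpow (by positivity : 2 * s ≠ 0)]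
    · have hpos : 0 < ‖ξ‖ := norm_pos_iff.mpr hξ
      rw [hiso ξ (‖ξ‖ • e) (by rw [norm_smul, hne]; simp), hscale _ hpos,
        Real.mul_rpow Real.two_pi_pos.le hpos.le]
      have : (2 * Real.pi) ^ (2 * s) ≠ 0 := by positivity
      field_simp

lemma norm_exp_two_pi_inner (ξ x : EuclideanSpace ℝ (Fin d)) :
    ‖Complex.exp (2 * Real.pi * inner ℝ ξ x * Complex.I)‖ = 1 := by
  have : (2 * (Real.pi : ℂ) * (inner ℝ ξ x : ℝ) * Complex.I) =
    ((2 * Real.pi * inner ℝ ξ x : ℝ) : ℂ) * Complex.I := by push_cast; ring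
  rw [this, Complex.norm_exp_ofReal_mul_I]

/-- The fractional Laplacian as a hypersingular integral of symmetric differences. -/
lemma exists_fracLaplacian_eq_integral [NeZero d] {s : ℝ} (hs : 0 < s) {m : ℕ} (hm : s < m) :
    ∃ κ : ℝ, ∀ f : EuclideanSpace ℝ (Fin d) → ℝ, IsTest f → ∀ x,
      fracLaplacian s f x = ((κ * ∫ h : EuclideanSpace ℝ (Fin d),
        ‖h‖ ^ (-(d + 2 * s)) * (symDiff₂ h)^[m] f x : ℝ) : ℂ) := by
  obtain ⟨κ, hκ, hsymb⟩ := exists_hyperSymbol_eq (d := d) hs hm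
  refine ⟨κ⁻¹, fun f hf x => ?_⟩
  set F := 𝓕 (fun x => (f x : ℂ)) with hF
  set G : EuclideanSpace ℝ (Fin d) → EuclideanSpace ℝ (Fin d) → ℂ := fun h ξ =>
    Complex.exp (2 * Real.pi * inner ℝ ξ x * Complex.I) *
      ((‖h‖ ^ (-(d + 2 * s)) * (2 - 2 * Real.cos (2 * Real.pi * inner ℝ ξ h)) ^ m : ℝ) * F ξ)
    with hG
  have hnorm : ∀ h ξ, ‖G h ξ‖ =
      (‖h‖ ^ (-(d + 2 * s)) * (2 - 2 * Real.cos (2 * Real.pi * inner ℝ ξ h)) ^ m) * ‖F ξ‖ := by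
    intro h ξ
    have := two_sub_two_cos_nonneg (2 * Real.pi * inner ℝ ξ h)
    rw [hG]
    simp only
    rw [norm_mul, norm_exp_two_pi_inner, one_mul, norm_mul, Complex.norm_real,
      Real.norm_of_nonneg (by positivity)]
  have hFc := hf.continuous_fourier
  -- Integrating |G| in `h` first gives κ (2π|ξ|)^(2s) |F ξ|, which is integrable since F is a
  -- Schwartz function. This justifies Fubini.
  have hint : Integrable (Function.uncurry G) (volume.prod volume) := by
    rw [integrable_prod_iff']
    · constructor
      · filter_upwards with ξ
        exact (((integrable_hyperSymbol hs hm ξ).ofReal (𝕜 := ℂ)).mul_const (F ξ)).const_mul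
          (Complex.exp (2 * Real.pi * inner ℝ ξ x * Complex.I))
      · simp only [Function.uncurry, hnorm, integral_mul_const, hsymb]
        have := (hf.integrable_rpow_mul_fourier (a := 2 * s) (by positivity)).const_mul
          (κ * (2 * Real.pi) ^ (2 * s))
        refine this.congr ?_
        filter_upwards with ξ
        rw [Real.mul_rpow Real.two_pi_pos.le (norm_nonneg _)]
        ring
    · refine Measurable.aestronglyMeasurable ?_
      have := hFc.measurable
      rw [← hF] at this
      simp only [Function.uncurry_def, hG]
      fun_prop
  have h1 : ((∫ h : EuclideanSpace ℝ (Fin d),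
        ‖h‖ ^ (-(d + 2 * s)) * (symDiff₂ h)^[m] f x : ℝ) : ℂ) = ∫ h, ∫ ξ, G h ξ := by
    rw [← integral_complex_ofReal]
    congr 1 with h
    rw [Complex.ofReal_mul, symDiff₂_iterate_eq_integral m hf h x, ← integral_const_mul]
    congr 1 with ξ
    simp only [hG]
    push_cast
    ring
  rw [Complex.ofReal_mul, h1, integral_integral_swap hint, IsTest.fracLaplacian_eq,
    ← integral_const_mul]
  congr 1 with ξ
  simp only [hG]
  rw [integral_const_mul, integral_mul_const, integral_complex_ofReal, hsymb]
  have : (κ : ℂ) ≠ 0 := by exact_mod_cast hκ.ne'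
  simp only [← hF]
  push_cast
  field_simp

end Hypersingular

/-! ### Scaling, symmetry, decay and derivatives of the fractional Laplacian -/

section FracLap

variable {d : ℕ}

/-- The real-valued fractional Laplacian. -/
noncomputable def fracLap (s : ℝ) (f : EuclideanSpace ℝ (Fin d) → ℝ)
    (x : EuclideanSpace ℝ (Fin d)) : ℝ := (fracLaplacian s f x).re

lemma exists_fracLap_eq_integral [NeZero d] {s : ℝ} (hs : 0 < s) {m : ℕ} (hm : s < m) :
    ∃ κ : ℝ, ∀ f : EuclideanSpace ℝ (Fin d) → ℝ, IsTest f → ∀ x,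
      fracLap s f x = κ * ∫ h : EuclideanSpace ℝ (Fin d),
        ‖h‖ ^ (-(d + 2 * s)) * (symDiff₂ h)^[m] f x := by
  obtain ⟨κ, h⟩ := exists_fracLaplacian_eq_integral (d := d) hs hm
  exact ⟨κ, fun f hf x => by rw [fracLap, h f hf x, Complex.ofReal_re]⟩

lemma fracLaplacian_eq_ofReal [NeZero d] {s : ℝ} (hs : 0 < s)
    {f : EuclideanSpace ℝ (Fin d) → ℝ} (hf : IsTest f) (x : EuclideanSpace ℝ (Fin d)) :
    fracLaplacian s f x = (fracLap s f x : ℂ) := by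
  obtain ⟨m, hm⟩ := exists_nat_gt s
  obtain ⟨κ, h⟩ := exists_fracLaplacian_eq_integral (d := d) hs hm
  rw [fracLap, h f hf x, Complex.ofReal_re]

lemma IsTest.comp_affine {f : EuclideanSpace ℝ (Fin d) → ℝ} (hf : IsTest f) {t : ℝ} (ht : 0 < t)
    (a : EuclideanSpace ℝ (Fin d)) : IsTest (fun y => f (t • (a - y))) := by
  refine ⟨hf.contDiff.comp (by fun_prop), ?_⟩
  exact hf.hasCompactSupport.comp_homeomorph
    ((Homeomorph.subLeft a).trans (Homeomorph.smulOfNeZero t ht.ne'))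

lemma IsTest.partialDeriv {f : EuclideanSpace ℝ (Fin d) → ℝ} (hf : IsTest f) (i : Fin d) :
    IsTest (partialDeriv i f) := by
  refine ⟨?_, hf.hasCompactSupport.fderiv_apply (𝕜 := ℝ) _⟩
  exact (hf.contDiff.fderiv_right (m := ∞) (by simp)).clm_apply contDiff_const

/-- Substituting h ↦ -th in the hypersingular integral gives the homogeneity. It reduces testing
against all dilated and translated bumps to a single fixed profile. -/
lemma fracLap_comp_affine [NeZero d] {s : ℝ} (hs : 0 < s)
    {f : EuclideanSpace ℝ (Fin d) → ℝ} (hf : IsTest f) {t : ℝ} (ht : 0 < t)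
    (a x : EuclideanSpace ℝ (Fin d)) :
    fracLap s (fun y => f (t • (a - y))) x = t ^ (2 * s) * fracLap s f (t • (a - x)) := by
  obtain ⟨m, hm⟩ := exists_nat_gt s
  obtain ⟨κ, h⟩ := exists_fracLap_eq_integral (d := d) hs hm
  rw [h _ (hf.comp_affine ht a), h f hf]
  simp only [symDiff₂_iterate_affine]
  have key := Measure.integral_comp_smul (μ := (volume : Measure (EuclideanSpace ℝ (Fin d))))
      (fun h => ‖h‖ ^ (-(d + 2 * s)) * (symDiff₂ h)^[m] f (t • (a - x))) (-t)
  simp only [norm_smul, Real.norm_eq_abs, abs_neg, abs_of_pos ht,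
    Real.mul_rpow ht.le (norm_nonneg _), mul_assoc, smul_eq_mul, finrank_euclideanSpace_fin,
    abs_inv, abs_pow] at key
  rw [integral_const_mul] at key
  set I := ∫ h : EuclideanSpace ℝ (Fin d),
    ‖h‖ ^ (-(d + 2 * s)) * (symDiff₂ (-t • h))^[m] f (t • (a - x))
  have h2 : I = t ^ (d + 2 * s) * (t ^ (-(d + 2 * s)) * I) := by
    rw [← mul_assoc, ← Real.rpow_add ht]; simp
  rw [h2, key, ← Real.rpow_natCast, ← Real.rpow_neg ht.le]
  have h3 : t ^ (2 * s) = t ^ (d + 2 * s) * t ^ (-(d : ℝ)) := by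
    rw [← Real.rpow_add ht]; congr 1; ring
  rw [h3]
  ring

lemma fracLap_comp_isometry [NeZero d] {s : ℝ} (hs : 0 < s)
    {f : EuclideanSpace ℝ (Fin d) → ℝ} (hf : IsTest f)
    (A : EuclideanSpace ℝ (Fin d) ≃ₗᵢ[ℝ] EuclideanSpace ℝ (Fin d))
    (hA : ∀ x, f (A x) = f x) (x : EuclideanSpace ℝ (Fin d)) :
    fracLap s f (A x) = fracLap s f x := by
  obtain ⟨m, hm⟩ := exists_nat_gt s
  obtain ⟨κ, h⟩ := exists_fracLap_eq_integral (d := d) hs hm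
  rw [h f hf, h f hf]
  congr 1
  rw [← A.measurePreserving.integral_comp A.toHomeomorph.measurableEmbedding]
  simp only [LinearIsometryEquiv.norm_map, ← symDiff₂_iterate_comp_isometry, hA]

lemma norm_fracLaplacian_le (s : ℝ) (f : EuclideanSpace ℝ (Fin d) → ℝ) (x : EuclideanSpace ℝ (Fin d)) :
    ‖fracLaplacian s f x‖ ≤
      ∫ ξ, (2 * Real.pi * ‖ξ‖) ^ (2 * s) * ‖𝓕 (fun x => (f x : ℂ)) ξ‖ := by
  rw [IsTest.fracLaplacian_eq]
  refine (norm_integral_le_integral_norm _).trans (le_of_eq ?_)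
  congr 1 with ξ
  rw [norm_mul, norm_exp_two_pi_inner, norm_mul, Complex.norm_real,
    Real.norm_of_nonneg (by positivity), one_mul]

/-- Near the support the Fourier bound suffices. Far from it f(x) = 0, so only the samples f(x + jh)
with j ≠ 0 remain. Such a sample is nonzero only if |h| is comparable to |x| or larger, and there
the singular weight is O((1 + |x|)^(-d-2s)), while integrating the samples in `h` costs only the L¹
norm of `f`. -/
lemma exists_abs_fracLap_le [NeZero d] {s : ℝ} (hs : 0 < s)
    {f : EuclideanSpace ℝ (Fin d) → ℝ} (hf : IsTest f) :
    ∃ C, 0 ≤ C ∧ ∀ x, |fracLap s f x| ≤ C * (1 + ‖x‖) ^ (-(d + 2 * s)) := by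
  obtain ⟨m, hm⟩ := exists_nat_gt s
  have hm0 : 0 < m := by
    rcases Nat.eq_zero_or_pos m with rfl | h
    · simp at hm; linarith
    · exact h
  obtain ⟨κ, h⟩ := exists_fracLap_eq_integral (d := d) hs hm
  obtain ⟨a, ha0, ha⟩ : ∃ a : ℝ, 0 < a ∧ ∀ y, a ≤ ‖y‖ → f y = 0 := by
    obtain ⟨a, ha0, ha⟩ := hf.hasCompactSupport.isBounded.exists_pos_norm_le
    refine ⟨a + 1, by positivity, fun y hy => ?_⟩
    by_contra hne
    linarith [ha y (subset_tsupport _ hne)]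
  have hq : 0 < d + 2 * s := by positivity
  set q := d + 2 * s with hqdef
  set B := ∫ ξ, (2 * Real.pi * ‖ξ‖) ^ (2 * s) * ‖𝓕 (fun x => (f x : ℂ)) ξ‖ with hB
  have hB0 : 0 ≤ B := integral_nonneg fun ξ => by positivity
  set J := (Finset.Icc (-m : ℤ) m).erase 0 with hJ
  set D := ∑ j ∈ J, |((j : ℝ) ^ d)⁻¹| * ∫ y, |f y| with hD
  have hD0 : 0 ≤ D := Finset.sum_nonneg fun j _ =>
    mul_nonneg (abs_nonneg _) (integral_nonneg fun _ => abs_nonneg _)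
  have hle : ∀ x, |fracLap s f x| ≤ B := fun x =>
    (Complex.abs_re_le_norm _).trans (norm_fracLaplacian_le s f x)
  clear_value q B D
  refine ⟨B * (2 + 2 * a) ^ q + |κ| * (4 ^ m * (4 * m) ^ q * D), by positivity, fun x => ?_⟩
  have hx1 : 0 < 1 + ‖x‖ := by positivity
  rcases le_total ‖x‖ (2 * a + 1) with hx | hx
  · have h1 := hle x
    have h2 : 1 ≤ (2 + 2 * a) ^ q * (1 + ‖x‖) ^ (-q) := by
      rw [Real.rpow_neg hx1.le, ← div_eq_mul_inv, one_le_div (by positivity)]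
      exact Real.rpow_le_rpow hx1.le (by linarith) hq.le
    calc |fracLap s f x| ≤ B * ((2 + 2 * a) ^ q * (1 + ‖x‖) ^ (-q)) :=
          h1.trans (le_mul_of_one_le_right hB0 h2)
      _ ≤ _ := by
        rw [← mul_assoc]
        exact mul_le_mul_of_nonneg_right (le_add_of_nonneg_right (by positivity)) (by positivity)
  · have hfx : f x = 0 := ha x (by linarith)
    have hfi : Integrable f := hf.contDiff.continuous.integrable_of_hasCompactSupport
      hf.hasCompactSupport
    have hint : ∀ j ∈ J, Integrable (fun h : EuclideanSpace ℝ (Fin d) => |f (x + j • h)|) ∧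
        ∫ h : EuclideanSpace ℝ (Fin d), |f (x + j • h)| = |((j : ℝ) ^ d)⁻¹| * ∫ y, |f y| := by
      intro j hj
      have hj0 : (j : ℝ) ≠ 0 := by
        rw [hJ, Finset.mem_erase] at hj; exact_mod_cast hj.1
      have e : (fun h : EuclideanSpace ℝ (Fin d) => |f (x + j • h)|) =
          fun h => (fun y => |f (x + y)|) ((j : ℝ) • h) := by
        ext h; simp only [Int.cast_smul_eq_zsmul]
      rw [e]
      constructor
      · exact (hfi.comp_add_left x).abs.comp_smul hj0
      · rw [Measure.integral_comp_smul volume (fun y => |f (x + y)|), finrank_euclideanSpace_fin, smul_eq_mul,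
          integral_add_left_eq_self (fun y => |f y|)]
    have hbound : ∀ h : EuclideanSpace ℝ (Fin d),
        ‖‖h‖ ^ (-q) * (symDiff₂ h)^[m] f x‖ ≤
        4 ^ m * ((4 * m) ^ q * (1 + ‖x‖) ^ (-q)) * ∑ j ∈ J, |f (x + j • h)| := by
      intro h
      rw [norm_mul, Real.norm_of_nonneg (by positivity), Real.norm_eq_abs]
      have hsum : ∑ j ∈ Finset.Icc (-m : ℤ) m, |f (x + j • h)| = ∑ j ∈ J, |f (x + j • h)| := by
        rw [hJ, Finset.sum_erase]
        simp [hfx]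
      have h1 := abs_symDiff₂_iterate_le m h f x
      rw [hsum] at h1
      calc ‖h‖ ^ (-q) * |(symDiff₂ h)^[m] f x|
          ≤ ‖h‖ ^ (-q) * (4 ^ m * ∑ j ∈ J, |f (x + j • h)|) := by gcongr
        _ = 4 ^ m * ∑ j ∈ J, ‖h‖ ^ (-q) * |f (x + j • h)| := by rw [← Finset.mul_sum]; ring
        _ ≤ 4 ^ m * ∑ j ∈ J, ((4 * m) ^ q * (1 + ‖x‖) ^ (-q)) * |f (x + j • h)| := by
          gcongr 4 ^ m * ?_
          refine Finset.sum_le_sum fun j hj => ?_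
          by_cases hz : a ≤ ‖x + j • h‖
          · rw [ha _ hz]; simp
          gcongr
          push Not at hz
          have hjm : |(j : ℝ)| ≤ m := by
            rw [hJ, Finset.mem_erase, Finset.mem_Icc] at hj
            rw [abs_le]
            exact ⟨by exact_mod_cast hj.2.1, by exact_mod_cast hj.2.2⟩
          have hjh : ‖j • h‖ ≤ m * ‖h‖ := by
            rw [← Int.cast_smul_eq_zsmul ℝ, norm_smul, Real.norm_eq_abs]
            gcongr
          have htri : ‖x‖ ≤ ‖x + j • h‖ + ‖j • h‖ := by
            simpa using norm_sub_le (x + j • h) (j • h)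
          have hm0' : (0 : ℝ) < m := by exact_mod_cast hm0
          -- From |x + jh| < a and |x| ≥ 2a + 1 follows m|h| ≥ |x| - a ≥ (1 + |x|)/2.
          have hlow : (1 + ‖x‖) / (4 * m) ≤ ‖h‖ := by
            rw [div_le_iff₀ (by positivity)]
            nlinarith
          calc ‖h‖ ^ (-q) ≤ ((1 + ‖x‖) / (4 * m)) ^ (-q) :=
                Real.rpow_le_rpow_of_nonpos (by positivity) hlow (by linarith)
            _ = _ := by
              rw [Real.div_rpow hx1.le (by positivity), Real.rpow_neg (by positivity : (0:ℝ) ≤ 4 * m)]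
              field_simp
        _ = _ := by rw [← Finset.mul_sum]; ring
    have hsumint : Integrable (fun h : EuclideanSpace ℝ (Fin d) => ∑ j ∈ J, |f (x + j • h)|) :=
      integrable_finsetSum _ fun j hj => (hint j hj).1
    have h2 := norm_integral_le_of_norm_le (hsumint.const_mul
      (4 ^ m * ((4 * m) ^ q * (1 + ‖x‖) ^ (-q)))) (Filter.Eventually.of_forall hbound)
    rw [integral_const_mul, integral_finsetSum _ fun j hj => (hint j hj).1,
      Finset.sum_congr rfl fun j hj => (hint j hj).2, ← hD] at h2
    rw [h f hf x, abs_mul]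
    calc |κ| * |∫ h : EuclideanSpace ℝ (Fin d), ‖h‖ ^ (-q) * (symDiff₂ h)^[m] f x|
        ≤ |κ| * (4 ^ m * ((4 * m) ^ q * (1 + ‖x‖) ^ (-q)) * D) := by gcongr; exact h2
      _ = (|κ| * (4 ^ m * (4 * m) ^ q * D)) * (1 + ‖x‖) ^ (-q) := by ring
      _ ≤ _ := mul_le_mul_of_nonneg_right (le_add_of_nonneg_left (by positivity)) (by positivity)

lemma fourier_partialDeriv {f : EuclideanSpace ℝ (Fin d) → ℝ} (hf : IsTest f) (i : Fin d)
    (ξ : EuclideanSpace ℝ (Fin d)) :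
    𝓕 (fun x => (partialDeriv i f x : ℂ)) ξ =
      2 * Real.pi * Complex.I * ξ i * 𝓕 (fun x => (f x : ℂ)) ξ := by
  have hd : Differentiable ℝ (fun x => (f x : ℂ)) := hf.schwartz.differentiable
  have hdi : Integrable (fderiv ℝ (fun x => (f x : ℂ))) :=
    (SchwartzMap.fderivCLM ℝ _ _ hf.schwartz).integrable
  have h1 : 𝓕 (fderiv ℝ (fun x => (f x : ℂ))) ξ = _ :=
    congrFun (Real.fourier_fderiv hf.schwartz.integrable hd hdi) ξ
  have h2 : (fun x => (partialDeriv i f x : ℂ)) =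
      fun x => fderiv ℝ (fun x => (f x : ℂ)) x (EuclideanSpace.single i 1) := by
    ext x
    have h3 : HasFDerivAt (fun x => (f x : ℂ)) (Complex.ofRealCLM ∘L fderiv ℝ f x) x :=
      Complex.ofRealCLM.hasFDerivAt.comp x
        (hf.contDiff.differentiable (by simp)).differentiableAt.hasFDerivAt
    rw [h3.fderiv]
    rfl
  rw [h2, ← Real.fourier_continuousLinearMap_apply hdi, h1, VectorFourier.fourierSMulRight_apply]
  simp [EuclideanSpace.inner_single_right, innerSL_apply_apply ℝ, hf.coe_schwartz]
  ring

/-- The function is an inverse Fourier transform of a density `g` with an integrable first moment,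
so it may be differentiated under the integral. The factor 2πi ξ_i thus produced is the symbol of
∂_i, whence ∂_i commutes with (-Δ)^s. -/
lemma hasFDerivAt_fracLap [NeZero d] {s : ℝ} (hs : 0 < s)
    {f : EuclideanSpace ℝ (Fin d) → ℝ} (hf : IsTest f) (x : EuclideanSpace ℝ (Fin d)) :
    ∃ L : EuclideanSpace ℝ (Fin d) →L[ℝ] ℝ, HasFDerivAt (fracLap s f) L x ∧
      ∀ i, L (EuclideanSpace.single i 1) = fracLap s (partialDeriv i f) x := by
  set g : EuclideanSpace ℝ (Fin d) → ℂ := fun ξ => (((2 * Real.pi * ‖ξ‖) ^ (2 * s) : ℝ) : ℂ) *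
      𝓕 (fun x => (f x : ℂ)) ξ with hg
  have hgc : Continuous g := by
    have h1 : Continuous fun ξ : EuclideanSpace ℝ (Fin d) => (2 * Real.pi * ‖ξ‖) ^ (2 * s) :=
      (by fun_prop : Continuous fun ξ : EuclideanSpace ℝ (Fin d) =>
        2 * Real.pi * ‖ξ‖).rpow_const fun _ => Or.inr (by positivity)
    exact (Complex.continuous_ofReal.comp h1).mul hf.continuous_fourier
  have hnorm : ∀ ξ, ‖g ξ‖ = (2 * Real.pi) ^ (2 * s) * (‖ξ‖ ^ (2 * s) *
      ‖𝓕 (fun x => (f x : ℂ)) ξ‖) := by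
    intro ξ
    rw [hg]
    simp only
    rw [norm_mul, Complex.norm_real, Real.norm_of_nonneg (by positivity),
      Real.mul_rpow Real.two_pi_pos.le (norm_nonneg _), mul_assoc]
  have hgi : Integrable g := by
    rw [← integrable_norm_iff hgc.aestronglyMeasurable]
    simp only [hnorm]
    exact (hf.integrable_rpow_mul_fourier (by positivity)).const_mul _
  have hgi' : Integrable (fun ξ => ‖ξ‖ * ‖g ξ‖) := by
    have := (hf.integrable_rpow_mul_fourier (a := 1 + 2 * s) (by positivity)).const_mul
      ((2 * Real.pi) ^ (2 * s))
    refine this.congr ?_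
    filter_upwards with ξ
    rw [hnorm, Real.rpow_add_of_nonneg (norm_nonneg _) zero_le_one (by positivity), Real.rpow_one]
    ring
  have hinv : fracLaplacian s f = fun y => 𝓕 g (-y) := by
    ext y
    rw [fracLaplacian, Real.fourierInv_eq_fourier_neg]
  have h1 := (Real.hasFDerivAt_fourier hgi hgi' (-x)).comp x (hasFDerivAt_id x).neg
  have h2 : HasFDerivAt (fracLaplacian s f)
      (𝓕 (VectorFourier.fourierSMulRight (innerSL ℝ) g) (-x) ∘L
        (-ContinuousLinearMap.id ℝ (EuclideanSpace ℝ (Fin d)))) x := by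
    rw [hinv]; exact h1
  refine ⟨_, (Complex.reCLM.hasFDerivAt (x := fracLaplacian s f x)).comp x h2, fun i => ?_⟩
  have hint : Integrable (VectorFourier.fourierSMulRight (innerSL ℝ) g) := by
    refine (hgi'.const_mul (2 * Real.pi * ‖innerSL ℝ (E := EuclideanSpace ℝ (Fin d))‖)).mono' ?_ ?_
    · exact hgc.aestronglyMeasurable.fourierSMulRight
    · filter_upwards with ξ
      refine (VectorFourier.norm_fourierSMulRight_le _ _ _).trans (le_of_eq (by ring))
  simp only [ContinuousLinearMap.comp_apply, neg_apply,
    ContinuousLinearMap.id_apply, map_neg]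
  rw [Real.fourier_continuousLinearMap_apply hint, fracLap, fracLaplacian,
    Real.fourierInv_eq_fourier_neg]
  rw [← map_neg]
  rw [Complex.reCLM_apply]
  congr 1
  have : (fun ξ : EuclideanSpace ℝ (Fin d) => (((2 * Real.pi * ‖ξ‖) ^ (2 * s) : ℝ) : ℂ) *
      𝓕 (fun x => (partialDeriv i f x : ℂ)) ξ) =
      fun ξ => - VectorFourier.fourierSMulRight (innerSL ℝ) g ξ (EuclideanSpace.single i 1) := by
    ext ξ
    rw [fourier_partialDeriv hf, VectorFourier.fourierSMulRight_apply]
    simp [EuclideanSpace.inner_single_right, innerSL_apply_apply ℝ, hg]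
    ring
  rw [this, Real.fourier_eq, Real.fourier_eq, ← integral_neg]
  simp

end FracLap

/-! ### Iterated partial derivatives and smooth decaying functions -/

section IteratedPartial

variable {d : ℕ}

/-- Iterated partial derivatives along a list of coordinates. -/
noncomputable def iterPartial (l : List (Fin d)) (f : EuclideanSpace ℝ (Fin d) → ℝ) :
    EuclideanSpace ℝ (Fin d) → ℝ :=
  l.foldr (fun i g => partialDeriv i g) f

@[simp] lemma iterPartial_nil (f : EuclideanSpace ℝ (Fin d) → ℝ) : iterPartial [] f = f := rfl

@[simp] lemma iterPartial_cons (i : Fin d) (l : List (Fin d))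
    (f : EuclideanSpace ℝ (Fin d) → ℝ) :
    iterPartial (i :: l) f = partialDeriv i (iterPartial l f) := rfl

lemma iterPartial_replicate_append (k : ℕ) (i : Fin d) (l : List (Fin d))
    (f : EuclideanSpace ℝ (Fin d) → ℝ) :
    iterPartial (List.replicate k i ++ l) f = (partialDeriv i)^[k] (iterPartial l f) := by
  induction k with
  | zero => simp
  | succ k ih => rw [List.replicate_succ, List.cons_append, iterPartial_cons, ih,
      Function.iterate_succ_apply']

lemma exists_list_multiDeriv_eq (n : Fin d → ℕ) : ∃ l : List (Fin d), l.length = ∑ i, n i ∧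
    ∀ f, multiDeriv n f = iterPartial l f := by
  have key : ∀ L : List (Fin d), ∀ f, L.foldr (fun i g => (partialDeriv i)^[n i] g) f =
      iterPartial (L.flatMap fun i => List.replicate (n i) i) f := by
    intro L f
    induction L with
    | nil => rfl
    | cons i L ih => rw [List.foldr_cons, List.flatMap_cons, iterPartial_replicate_append, ih]
  refine ⟨(List.finRange d).flatMap fun i => List.replicate (n i) i, ?_, key _⟩
  rw [List.length_flatMap]
  simp only [List.length_replicate, Fin.sum_univ_def]

lemma fderiv_eq_sum_partialDeriv (f : EuclideanSpace ℝ (Fin d) → ℝ)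
    (x : EuclideanSpace ℝ (Fin d)) :
    fderiv ℝ f x = ∑ i, partialDeriv i f x • (EuclideanSpace.proj i : EuclideanSpace ℝ (Fin d) →L[ℝ] ℝ) := by
  refine ContinuousLinearMap.coe_injective
    ((EuclideanSpace.basisFun (Fin d) ℝ).toBasis.ext fun j => ?_)
  simp [partialDeriv]

/-- A family of differentiable functions that is stable under partial derivatives consists of
smooth functions. -/
lemma contDiff_of_stable_partialDeriv {S : Set (EuclideanSpace ℝ (Fin d) → ℝ)}
    (h1 : ∀ f ∈ S, Differentiable ℝ f) (h2 : ∀ f ∈ S, ∀ i, partialDeriv i f ∈ S)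
    {f : EuclideanSpace ℝ (Fin d) → ℝ} (hf : f ∈ S) : ContDiff ℝ ∞ f := by
  rw [contDiff_infty]
  intro n
  induction n generalizing f with
  | zero => exact contDiff_zero.mpr (h1 f hf).continuous
  | succ n ih =>
    push_cast
    rw [contDiff_succ_iff_fderiv]
    refine ⟨h1 f hf, by simp, ?_⟩
    have : fderiv ℝ f = fun x => ∑ i, partialDeriv i f x •
        (EuclideanSpace.proj i : EuclideanSpace ℝ (Fin d) →L[ℝ] ℝ) := funext (fderiv_eq_sum_partialDeriv f)
    rw [this]
    exact ContDiff.sum fun i _ => (ih (h2 f hf i)).smul contDiff_const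

lemma contDiff_of_differentiable_iterPartial {f : EuclideanSpace ℝ (Fin d) → ℝ}
    (h : ∀ l, Differentiable ℝ (iterPartial l f)) : ContDiff ℝ ∞ f :=
  contDiff_of_stable_partialDeriv (S := Set.range fun l => iterPartial l f)
    (by rintro _ ⟨l, rfl⟩; exact h l) (by rintro _ ⟨l, rfl⟩ i; exact ⟨i :: l, rfl⟩) ⟨[], rfl⟩

lemma ContDiff.partialDeriv {f : EuclideanSpace ℝ (Fin d) → ℝ} (hf : ContDiff ℝ ∞ f) (i : Fin d) :
    ContDiff ℝ ∞ (partialDeriv i f) :=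
  (hf.fderiv_right (m := ∞) (by simp)).clm_apply contDiff_const

lemma ContDiff.iterPartial {f : EuclideanSpace ℝ (Fin d) → ℝ} (hf : ContDiff ℝ ∞ f)
    (l : List (Fin d)) : ContDiff ℝ ∞ (iterPartial l f) := by
  induction l with
  | nil => exact hf
  | cons i l ih => exact ContDiff.partialDeriv ih i

lemma IsTest.iterPartial {f : EuclideanSpace ℝ (Fin d) → ℝ} (hf : IsTest f)
    (l : List (Fin d)) : IsTest (iterPartial l f) := by
  induction l with
  | nil => exact hf
  | cons i l ih => exact IsTest.partialDeriv ih i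

/-- Smooth functions all of whose partial derivatives are `O((1 + |x|)^{-(d + δ)})`. -/
structure SmoothDecay (δ : ℝ) (f : EuclideanSpace ℝ (Fin d) → ℝ) : Prop where
  contDiff : ContDiff ℝ ∞ f
  decay : ∀ l, ∃ C, 0 ≤ C ∧ ∀ x, |iterPartial l f x| ≤ C * (1 + ‖x‖) ^ (-(d + δ))

lemma SmoothDecay.iterPartial {δ : ℝ} {f : EuclideanSpace ℝ (Fin d) → ℝ} (hf : SmoothDecay δ f)
    (l : List (Fin d)) : SmoothDecay δ (iterPartial l f) := by
  refine ⟨hf.contDiff.iterPartial l, fun l' => ?_⟩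
  have : _root_.iterPartial l' (_root_.iterPartial l f) = _root_.iterPartial (l' ++ l) f := by
    simp [_root_.iterPartial]
  rw [this]
  exact hf.decay _

lemma partialDeriv_fracLap [NeZero d] {s : ℝ} (hs : 0 < s)
    {f : EuclideanSpace ℝ (Fin d) → ℝ} (hf : IsTest f) (i : Fin d) :
    partialDeriv i (fracLap s f) = fracLap s (partialDeriv i f) := by
  ext x
  obtain ⟨L, hL, h⟩ := hasFDerivAt_fracLap hs hf x
  rw [partialDeriv, hL.fderiv, h]

lemma iterPartial_fracLap [NeZero d] {s : ℝ} (hs : 0 < s)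
    {f : EuclideanSpace ℝ (Fin d) → ℝ} (hf : IsTest f) (l : List (Fin d)) :
    iterPartial l (fracLap s f) = fracLap s (iterPartial l f) := by
  induction l with
  | nil => rfl
  | cons i l ih => rw [iterPartial_cons, iterPartial_cons, ih,
      partialDeriv_fracLap hs (hf.iterPartial l)]

/-- Partial derivatives pass onto the test function, so the decay bound applies to all of them. The
rate δ is left free below 2s because the averaging over dilations requires δ < 1. -/
lemma smoothDecay_fracLap [NeZero d] {s δ : ℝ} (hs : 0 < s) (hδ : δ ≤ 2 * s)
    {f : EuclideanSpace ℝ (Fin d) → ℝ} (hf : IsTest f) : SmoothDecay δ (fracLap s f) := by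
  refine ⟨contDiff_of_differentiable_iterPartial fun l x => ?_, fun l => ?_⟩
  · rw [iterPartial_fracLap hs hf]
    obtain ⟨L, hL, -⟩ := hasFDerivAt_fracLap hs (hf.iterPartial l) x
    exact hL.differentiableAt
  · obtain ⟨C, hC, h⟩ := exists_abs_fracLap_le hs (hf.iterPartial l)
    refine ⟨C, hC, fun x => ?_⟩
    rw [iterPartial_fracLap hs hf]
    refine (h x).trans ?_
    gcongr
    linarith [norm_nonneg x]

end IteratedPartial

/-! ### Averages over dilations -/

section DilationAverage

variable {d : ℕ}

/-- The weighted average `∫₀¹ λ^k f(λ x) dλ` of the dilations of `f`. -/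
noncomputable def dilationAverage (k : ℕ) (f : EuclideanSpace ℝ (Fin d) → ℝ)
    (x : EuclideanSpace ℝ (Fin d)) : ℝ :=
  ∫ t in (0 : ℝ)..1, t ^ k * f (t • x)

lemma hasFDerivAt_dilationAverage (k : ℕ) {f : EuclideanSpace ℝ (Fin d) → ℝ}
    (hf : ContDiff ℝ ∞ f) (x : EuclideanSpace ℝ (Fin d)) :
    HasFDerivAt (dilationAverage k f)
      (∫ t in (0 : ℝ)..1, (t ^ (k + 1)) • fderiv ℝ f (t • x)) x := by
  have hc : Continuous f := hf.continuous
  have hfd : Continuous (fderiv ℝ f) := hf.continuous_fderiv (by simp)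
  obtain ⟨C, hC⟩ := (isCompact_closedBall (0 : EuclideanSpace ℝ (Fin d)) (‖x‖ + 1)).exists_bound_of_continuousOn
    hfd.continuousOn
  refine (intervalIntegral.hasFDerivAt_integral_of_dominated_of_fderiv_le
    (𝕜 := ℝ) (F := fun x t => t ^ k * f (t • x))
    (F' := fun x t => t ^ (k + 1) • fderiv ℝ f (t • x)) (bound := fun _ => C) (Metric.ball_mem_nhds x one_pos)
    ?_ ?_ ?_ ?_ ?_ ?_)
  · filter_upwards with y
    exact Continuous.aestronglyMeasurable (by fun_prop)
  · exact Continuous.intervalIntegrable (by fun_prop) _ _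
  · exact Continuous.aestronglyMeasurable (by fun_prop)
  · filter_upwards with t ht y hy
    rw [Set.uIoc_of_le zero_le_one] at ht
    have hy' : ‖y‖ ≤ ‖x‖ + 1 := by
      rw [Metric.mem_ball, dist_eq_norm] at hy
      have := norm_add_le x (y - x)
      rw [add_sub_cancel] at this
      linarith
    have hmem : t • y ∈ Metric.closedBall (0 : EuclideanSpace ℝ (Fin d)) (‖x‖ + 1) := by
      rw [mem_closedBall_zero_iff, norm_smul, Real.norm_of_nonneg ht.1.le]
      nlinarith [norm_nonneg y, ht.2, ht.1]
    rw [norm_smul, norm_pow, Real.norm_of_nonneg ht.1.le]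
    calc t ^ (k + 1) * ‖fderiv ℝ f (t • y)‖ ≤ 1 * C := by
          gcongr
          · exact pow_le_one₀ ht.1.le ht.2
          · exact hC _ hmem
      _ = C := one_mul C
  · simp
  · filter_upwards with t ht y hy
    have h1 : HasFDerivAt (fun y : EuclideanSpace ℝ (Fin d) => t • y)
        (t • ContinuousLinearMap.id ℝ _) y := (hasFDerivAt_id y).const_smul t
    have h2 := ((hf.differentiable (by simp) (t • y)).hasFDerivAt.comp y h1).const_mul (t ^ k)
    refine h2.congr_fderiv ?_
    ext v
    simp [pow_succ, mul_assoc]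

/-- The chain rule produces a factor λ, so each derivative raises the weight exponent by one. This
gain makes the derivatives easier to bound than the average itself. -/
lemma partialDeriv_dilationAverage (k : ℕ) {f : EuclideanSpace ℝ (Fin d) → ℝ}
    (hf : ContDiff ℝ ∞ f) (i : Fin d) :
    partialDeriv i (dilationAverage k f) = dilationAverage (k + 1) (partialDeriv i f) := by
  ext x
  have hfd : Continuous (fderiv ℝ f) := hf.continuous_fderiv (by simp)
  rw [partialDeriv, (hasFDerivAt_dilationAverage k hf x).fderiv,
    ContinuousLinearMap.intervalIntegral_apply]
  · rfl
  · exact Continuous.intervalIntegrable (by fun_prop) _ _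

lemma iterPartial_dilationAverage (k : ℕ) {f : EuclideanSpace ℝ (Fin d) → ℝ}
    (hf : ContDiff ℝ ∞ f) (l : List (Fin d)) :
    iterPartial l (dilationAverage k f) = dilationAverage (k + l.length) (iterPartial l f) := by
  induction l with
  | nil => rfl
  | cons i l ih =>
    rw [iterPartial_cons, ih, partialDeriv_dilationAverage _ (hf.iterPartial l), List.length_cons,
      iterPartial_cons, add_assoc]

/-- For 0 < λ ≤ 1 one has 1 + |λx| ≥ λ(1 + |x|), so the integrand is at most C λ^(-δ) (1 +
|x|)^(-d-δ) once k ≥ d. Integrability at 0 is the condition δ < 1. -/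
lemma abs_dilationAverage_le {k : ℕ} (hk : d ≤ k) {δ : ℝ} (hδ0 : 0 < δ) (hδ : δ < 1) {C : ℝ}
    (hC : 0 ≤ C) {f : EuclideanSpace ℝ (Fin d) → ℝ}
    (hf : ∀ x, |f x| ≤ C * (1 + ‖x‖) ^ (-(d + δ))) (x : EuclideanSpace ℝ (Fin d)) :
    |dilationAverage k f x| ≤ C * (1 - δ)⁻¹ * (1 + ‖x‖) ^ (-(d + δ)) := by
  have hint : IntervalIntegrable (fun t : ℝ => C * (1 + ‖x‖) ^ (-(d + δ)) * t ^ (-δ)) volume 0 1 :=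
    (intervalIntegral.intervalIntegrable_rpow' (by linarith)).const_mul _
  have h := intervalIntegral.norm_integral_le_of_norm_le (f := fun t => t ^ k * f (t • x))
    zero_le_one ?_ hint
  · rw [intervalIntegral.integral_const_mul, integral_rpow (Or.inl (by linarith))] at h
    rw [dilationAverage]
    refine h.trans (le_of_eq ?_)
    rw [Real.one_rpow, Real.zero_rpow (by linarith)]
    rw [show -δ + 1 = 1 - δ by ring]
    ring
  · filter_upwards with t ht
    have hxp : 0 < 1 + ‖x‖ := by positivity
    have ht0 := ht.1
    rw [norm_mul, norm_pow, Real.norm_of_nonneg ht.1.le, Real.norm_eq_abs]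
    calc t ^ k * |f (t • x)| ≤ t ^ k * (C * (1 + ‖t • x‖) ^ (-(d + δ))) := by
          gcongr; exact hf _
      _ ≤ t ^ d * (C * (t * (1 + ‖x‖)) ^ (-(d + δ))) := by
        refine mul_le_mul (pow_le_pow_of_le_one ht0.le ht.2 hk) (mul_le_mul_of_nonneg_left ?_ hC)
          (mul_nonneg hC (by positivity)) (by positivity)
        refine Real.rpow_le_rpow_of_nonpos (by positivity) ?_ (by
          have : (0 : ℝ) ≤ d := Nat.cast_nonneg d
          linarith)
        rw [norm_smul, Real.norm_of_nonneg ht0.le]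
        linarith [ht.2]
      _ = C * (1 + ‖x‖) ^ (-(d + δ)) * (t ^ (d : ℝ) * t ^ (-(d + δ))) := by
        rw [Real.mul_rpow ht0.le hxp.le, Real.rpow_natCast]; ring
      _ = _ := by
        rw [← Real.rpow_add ht0]; congr 2; ring

/-- At the critical exponent k = d - 1 size alone leaves λ^(-1-δ), which is not integrable at 0. In
polar coordinates, however, mean zero says that the integral of λ^(d-1) f(λx) over (0, ∞) vanishes,
so the average equals minus the tail over (1, ∞), where the decay of `f` is effective. -/
lemma abs_dilationAverage_le_of_radial [NeZero d] {δ : ℝ} (hδ0 : 0 < δ) {C : ℝ}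
    {f : EuclideanSpace ℝ (Fin d) → ℝ}
    (hf : ∀ x, |f x| ≤ C * (1 + ‖x‖) ^ (-(d + δ)))
    (hrad : ∀ x y, ‖x‖ = ‖y‖ → f x = f y) (hint : Integrable f) (h0 : ∫ x, f x = 0) :
    ∃ C', 0 ≤ C' ∧ ∀ x, |dilationAverage (d - 1) f x| ≤ C' * (1 + ‖x‖) ^ (-(d + δ)) := by
  have hd : 1 ≤ d := NeZero.one_le
  have hC : 0 ≤ C := by have := (abs_nonneg _).trans (hf 0); simpa using this
  obtain ⟨e, hne⟩ : ∃ e : EuclideanSpace ℝ (Fin d), ‖e‖ = 1 :=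
    ⟨EuclideanSpace.single 0 1, by simp⟩
  have hq : (0 : ℝ) < d + δ := by positivity
  have hfe : ∀ x, f x = (fun r : ℝ => f (r • e)) ‖x‖ := fun x =>
    hrad _ _ (by rw [norm_smul, hne]; simp)
  have hI : IntegrableOn (fun r : ℝ => r ^ (d - 1) * f (r • e)) (Set.Ioi 0) := by
    have := (integrable_fun_norm_addHaar (μ := (volume : Measure (EuclideanSpace ℝ (Fin d))))
      (f := fun r : ℝ => f (r • e))).1 (hint.congr (Filter.Eventually.of_forall hfe))
    rwa [finrank_euclideanSpace_fin] at this
  have hI0 : ∫ r in Set.Ioi (0 : ℝ), r ^ (d - 1) * f (r • e) = 0 := by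
    have := integral_fun_norm_addHaar (volume : Measure (EuclideanSpace ℝ (Fin d)))
      (fun r : ℝ => f (r • e))
    rw [← integral_congr_ae (Filter.Eventually.of_forall hfe), h0, finrank_euclideanSpace_fin] at this
    simp only [smul_eq_mul, nsmul_eq_mul] at this
    have hv : 0 < volume.real (Metric.ball (0 : EuclideanSpace ℝ (Fin d)) 1) :=
      ENNReal.toReal_pos (Metric.measure_ball_pos volume 0 one_pos).ne' measure_ball_lt_top.ne
    have hd' : (0 : ℝ) < d := by exact_mod_cast hd
    rw [eq_comm, mul_eq_zero, mul_eq_zero] at this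
    rcases this with h | h | h
    · exact absurd h hd'.ne'
    · exact absurd h hv.ne'
    · exact h
  refine ⟨C * (1 + δ⁻¹) * 2 ^ (d + δ), by positivity, fun x => ?_⟩
  have hx1 : 0 < 1 + ‖x‖ := by positivity
  have hbd : ∀ y, |f y| ≤ C := fun y => (hf y).trans <| mul_le_of_le_one_right hC <|
    Real.rpow_le_one_of_one_le_of_nonpos (by linarith [norm_nonneg y]) (by linarith)
  rcases le_total ‖x‖ 1 with hx | hx
  · have h1 : |dilationAverage (d - 1) f x| ≤ C := by
      have := intervalIntegral.norm_integral_le_of_norm_le_const (a := (0 : ℝ)) (b := 1) (C := C)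
        (f := fun t => t ^ (d - 1) * f (t • x)) fun t ht => by
          rw [Set.uIoc_of_le zero_le_one] at ht
          rw [norm_mul, norm_pow, Real.norm_of_nonneg ht.1.le, Real.norm_eq_abs]
          calc t ^ (d - 1) * |f (t • x)| ≤ 1 * C := by
                gcongr
                · exact pow_le_one₀ ht.1.le ht.2
                · exact hbd _
            _ = C := one_mul C
      simpa [dilationAverage] using this
    have h2 : 1 ≤ 2 ^ (d + δ) * (1 + ‖x‖) ^ (-(d + δ)) := by
      rw [Real.rpow_neg hx1.le, ← div_eq_mul_inv, one_le_div (by positivity)]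
      exact Real.rpow_le_rpow hx1.le (by linarith) hq.le
    calc |dilationAverage (d - 1) f x| ≤ C * (1 + δ⁻¹) * 1 := by
          have : 0 ≤ C * δ⁻¹ := by positivity
          linarith
      _ ≤ C * (1 + δ⁻¹) * (2 ^ (d + δ) * (1 + ‖x‖) ^ (-(d + δ))) := by gcongr
      _ = _ := by ring
  · have hx0 : 0 < ‖x‖ := by linarith
    have hfx : ∀ t : ℝ, 0 < t → t ^ (d - 1) * f (t • x) =
        (‖x‖ ^ (d - 1))⁻¹ * ((‖x‖ * t) ^ (d - 1) * f ((‖x‖ * t) • e)) := by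
      intro t ht
      rw [hrad (t • x) ((‖x‖ * t) • e) (by
        rw [norm_smul, norm_smul, hne, norm_mul, norm_norm]; ring), mul_pow]
      field_simp
    have hIx : IntegrableOn (fun t : ℝ => t ^ (d - 1) * f (t • x)) (Set.Ioi 0) := by
      have h1 := (integrableOn_Ioi_comp_mul_left_iff
        (fun r : ℝ => r ^ (d - 1) * f (r • e)) 0 hx0).2 (by simpa using hI)
      refine (integrableOn_congr_fun (fun t ht => ?_) measurableSet_Ioi).2
        (h1.const_mul (‖x‖ ^ (d - 1))⁻¹)
      exact hfx t ht
    have hIx0 : ∫ t in Set.Ioi (0 : ℝ), t ^ (d - 1) * f (t • x) = 0 := by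
      rw [setIntegral_congr_fun measurableSet_Ioi (fun t ht => hfx t ht), integral_const_mul,
        integral_comp_mul_left_Ioi (fun r : ℝ => r ^ (d - 1) * f (r • e)) 0 hx0]
      simp [hI0]
    have hsplit : dilationAverage (d - 1) f x =
        -∫ t in Set.Ioi (1 : ℝ), t ^ (d - 1) * f (t • x) := by
      rw [dilationAverage, intervalIntegral.integral_of_le zero_le_one, eq_neg_iff_add_eq_zero,
        ← setIntegral_union (Set.Ioc_disjoint_Ioi le_rfl) measurableSet_Ioi
          (hIx.mono_set fun t ht => ht.1)
          (hIx.mono_set fun t ht => zero_lt_one.trans (Set.mem_Ioi.1 ht)),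
        Set.Ioc_union_Ioi_eq_Ioi zero_le_one, hIx0]
    have hmaj : IntegrableOn (fun t : ℝ => C * ‖x‖ ^ (-(d + δ)) * t ^ (-1 - δ)) (Set.Ioi 1) :=
      (integrableOn_Ioi_rpow_of_lt (by linarith) one_pos).const_mul _
    have h1 := norm_integral_le_of_norm_le (f := fun t : ℝ => t ^ (d - 1) * f (t • x)) hmaj (by
      filter_upwards [ae_restrict_mem measurableSet_Ioi] with t ht
      have ht0 : (0 : ℝ) < t := zero_lt_one.trans ht
      rw [norm_mul, norm_pow, Real.norm_of_nonneg ht0.le, Real.norm_eq_abs]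
      calc t ^ (d - 1) * |f (t • x)| ≤ t ^ (d - 1) * (C * (t * ‖x‖) ^ (-(d + δ))) := by
            gcongr
            refine (hf _).trans ?_
            gcongr C * ?_
            refine Real.rpow_le_rpow_of_nonpos (by positivity) ?_ (by linarith)
            rw [norm_smul, Real.norm_of_nonneg ht0.le]
            linarith
        _ = C * ‖x‖ ^ (-(d + δ)) * (t ^ ((d - 1 : ℕ) : ℝ) * t ^ (-(d + δ))) := by
            rw [Real.mul_rpow ht0.le hx0.le, Real.rpow_natCast]; ring
        _ = _ := by
            rw [← Real.rpow_add ht0]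
            congr 2
            push_cast [hd]; ring)
    rw [integral_const_mul, integral_Ioi_rpow_of_lt (by linarith) one_pos] at h1
    rw [hsplit, abs_neg]
    have h3 : ‖x‖ ^ (-(d + δ)) ≤ 2 ^ (d + δ) * (1 + ‖x‖) ^ (-(d + δ)) := by
      rw [Real.rpow_neg hx0.le, Real.rpow_neg hx1.le, ← div_eq_mul_inv, ← Real.div_rpow (by norm_num) hx1.le,
        ← Real.inv_rpow hx0.le]
      refine Real.rpow_le_rpow (by positivity) ?_ hq.le
      rw [inv_eq_one_div, div_le_div_iff₀ hx0 hx1]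
      linarith
    calc _ ≤ C * ‖x‖ ^ (-(d + δ)) * δ⁻¹ := by
          refine h1.trans (le_of_eq ?_)
          rw [Real.one_rpow]
          rw [show -1 - δ + 1 = -δ by ring]
          rw [neg_div_neg_eq, one_div]
      _ ≤ C * (2 ^ (d + δ) * (1 + ‖x‖) ^ (-(d + δ))) * (1 + δ⁻¹) := by
          gcongr
          linarith
      _ = _ := by ring

/-- The radial averages of a radial function of mean zero are again smooth and decaying. -/
lemma smoothDecay_dilationAverage [NeZero d] {δ : ℝ} (hδ0 : 0 < δ) (hδ : δ < 1)
    {f : EuclideanSpace ℝ (Fin d) → ℝ} (hf : SmoothDecay δ f)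
    (hrad : ∀ x y, ‖x‖ = ‖y‖ → f x = f y) (hint : Integrable f) (h0 : ∫ x, f x = 0) :
    SmoothDecay δ (dilationAverage (d - 1) f) := by
  refine ⟨contDiff_of_differentiable_iterPartial fun l x => ?_, fun l => ?_⟩
  · rw [iterPartial_dilationAverage _ hf.contDiff]
    exact (hasFDerivAt_dilationAverage _ (hf.contDiff.iterPartial l) x).differentiableAt
  · obtain ⟨C, hC, h⟩ := hf.decay l
    rw [iterPartial_dilationAverage _ hf.contDiff]
    -- Only the undifferentiated average needs cancellation; a single derivative already gives
    -- exponent at least d.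
    rcases l with _ | ⟨i, l⟩
    · exact abs_dilationAverage_le_of_radial hδ0 h hrad hint h0
    · refine ⟨C * (1 - δ)⁻¹, mul_nonneg hC (inv_nonneg.2 (by linarith)), fun x => ?_⟩
      refine abs_dilationAverage_le ?_ hδ0 hδ hC h x
      rw [List.length_cons]; omega

end DilationAverage

/-! ### Weighted integrability and convolution with decaying kernels -/

section Weighted

variable {d : ℕ}

/-- Functions integrable against the weight `(1 + |y|)^{-(d + δ)}`. -/
def WeightIntegrable (δ : ℝ) (u : EuclideanSpace ℝ (Fin d) → ℝ) : Prop :=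
  Integrable fun y => u y * (1 + ‖y‖) ^ (-(d + δ))

lemma continuous_one_add_norm_rpow (r : ℝ) :
    Continuous fun y : EuclideanSpace ℝ (Fin d) => (1 + ‖y‖) ^ r :=
  (continuous_const.add continuous_norm).rpow_const fun y =>
    Or.inl (add_pos_of_pos_of_nonneg one_pos (norm_nonneg y)).ne'

lemma WeightIntegrable.aestronglyMeasurable {δ : ℝ} {u : EuclideanSpace ℝ (Fin d) → ℝ}
    (hu : WeightIntegrable δ u) : AEStronglyMeasurable u := by
  have h1 := (Integrable.aestronglyMeasurable hu).mul
    (continuous_one_add_norm_rpow (d := d) (d + δ)).aestronglyMeasurable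
  refine h1.congr (Filter.Eventually.of_forall fun y => ?_)
  have : 0 < 1 + ‖y‖ := by positivity
  simp only [Pi.mul_apply]
  rw [mul_assoc, ← Real.rpow_add this]
  simp

/-- A Peetre-type inequality, uniform over dilations t ≥ b: moving the centre of the weight or
dilating it costs only a factor depending on x and b. -/
lemma weight_comp_le {q : ℝ} (hq : 0 ≤ q) {b t : ℝ} (hb : 0 < b) (hb1 : b ≤ 1) (hbt : b ≤ t)
    (x y : EuclideanSpace ℝ (Fin d)) :
    (1 + ‖t • (x - y)‖) ^ (-q) ≤ ((1 + ‖x‖) / b) ^ q * (1 + ‖y‖) ^ (-q) := by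
  have hx : 0 < 1 + ‖x‖ := by positivity
  have hy : 0 < 1 + ‖y‖ := by positivity
  have ht : 0 < t := hb.trans_le hbt
  have h1 : (1 + ‖y‖) * (b / (1 + ‖x‖)) ≤ 1 + ‖t • (x - y)‖ := by
    rw [← mul_div_assoc, div_le_iff₀ hx, norm_smul, Real.norm_of_nonneg ht.le]
    have h2 : ‖y‖ ≤ ‖x‖ + ‖x - y‖ := by
      have := norm_sub_le x (x - y)
      rwa [sub_sub_cancel] at this
    have h3 : b * ‖x - y‖ ≤ t * ‖x - y‖ := by gcongr
    have h4 := norm_nonneg (x - y)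
    have h5 : 0 ≤ t * ‖x - y‖ := by positivity
    nlinarith [norm_nonneg x, mul_nonneg h5 (norm_nonneg x)]
  calc (1 + ‖t • (x - y)‖) ^ (-q) ≤ ((1 + ‖y‖) * (b / (1 + ‖x‖))) ^ (-q) :=
        Real.rpow_le_rpow_of_nonpos (by positivity) h1 (by linarith)
    _ = _ := by
      rw [Real.mul_rpow hy.le (by positivity), Real.rpow_neg (by positivity : 0 ≤ b / (1 + ‖x‖)),
        ← Real.inv_rpow (by positivity), inv_div, mul_comm]

lemma weight_sub_le {q : ℝ} (hq : 0 ≤ q) (x y : EuclideanSpace ℝ (Fin d)) :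
    (1 + ‖x - y‖) ^ (-q) ≤ (1 + ‖x‖) ^ q * (1 + ‖y‖) ^ (-q) := by
  simpa using weight_comp_le hq one_pos le_rfl le_rfl x y

lemma WeightIntegrable.integrable_mul {δ : ℝ} {u : EuclideanSpace ℝ (Fin d) → ℝ}
    (hu : WeightIntegrable δ u) {K : EuclideanSpace ℝ (Fin d) → ℝ} (hK : Continuous K) {C : ℝ}
    (hC : ∀ y, |K y| ≤ C * (1 + ‖y‖) ^ (-(d + δ))) : Integrable fun y => u y * K y := by
  refine (hu.norm.const_mul C).mono' (hu.aestronglyMeasurable.mul hK.aestronglyMeasurable) ?_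
  filter_upwards with y
  have : 0 ≤ (1 + ‖y‖) ^ (-(d + δ)) := by positivity
  rw [norm_mul, norm_mul, Real.norm_eq_abs (K y), Real.norm_of_nonneg this, mul_left_comm]
  gcongr
  exact hC y

lemma integrable_weight {δ : ℝ} (hδ : 0 < δ) :
    Integrable fun y : EuclideanSpace ℝ (Fin d) => (1 + ‖y‖) ^ (-(d + δ)) :=
  integrable_one_add_norm (by rw [finrank_euclideanSpace_fin]; linarith)

lemma WeightIntegrable.of_bounded {δ : ℝ} (hδ : 0 < δ) {u : EuclideanSpace ℝ (Fin d) → ℝ}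
    (hu : AEStronglyMeasurable u) {C : ℝ} (hC : ∀ y, |u y| ≤ C) : WeightIntegrable δ u := by
  refine ((integrable_weight hδ).const_mul C).mono'
    (hu.mul (continuous_one_add_norm_rpow _).aestronglyMeasurable) ?_
  filter_upwards with y
  rw [norm_mul, Real.norm_eq_abs (u y), Real.norm_of_nonneg (by positivity)]
  gcongr
  exact hC y

/-- If r ≥ τ, then r = r^(1-p) r^p ≤ τ^(1-p) r^p. Splitting at a height τ and optimising it replaces
Hölder's inequality, with p = 1 included. -/
lemma abs_le_add_rpow {p : ℝ} (hp : 1 ≤ p) {τ : ℝ} (hτ : 0 < τ) {r : ℝ} (hr : 0 ≤ r) :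
    r ≤ τ + τ ^ (1 - p) * r ^ p := by
  rcases le_total r τ with h | h
  · have : 0 ≤ τ ^ (1 - p) * r ^ p := by positivity
    linarith
  · have hr0 : 0 < r := hτ.trans_le h
    have h1 : r ^ (1 - p) ≤ τ ^ (1 - p) := Real.rpow_le_rpow_of_nonpos hτ h (by linarith)
    have h2 : r ^ (1 - p) * r ^ p = r := by rw [← Real.rpow_add hr0]; simp
    have h3 : r ^ (1 - p) * r ^ p ≤ τ ^ (1 - p) * r ^ p := by gcongr
    linarith

lemma WeightIntegrable.of_memLp {δ : ℝ} (hδ : 0 < δ) {p : ℝ} (hp : 1 ≤ p)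
    {w : EuclideanSpace ℝ (Fin d) → ℝ} (hw : MemLp w (ENNReal.ofReal p) volume) :
    WeightIntegrable δ w := by
  have hp0 : 0 < p := by linarith
  have h1 : Integrable fun y => ‖w y‖ ^ p := by
    have := hw.integrable_norm_rpow (by simpa using hp0) ENNReal.ofReal_ne_top
    rwa [ENNReal.toReal_ofReal hp0.le] at this
  refine ((integrable_weight hδ).add h1).mono'
    (hw.aestronglyMeasurable.mul (continuous_one_add_norm_rpow _).aestronglyMeasurable) ?_
  filter_upwards with y
  have h2 := abs_le_add_rpow hp one_pos (norm_nonneg (w y))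
  rw [Real.one_rpow, one_mul] at h2
  have h3 : (1 + ‖y‖) ^ (-(d + δ)) ≤ 1 :=
    Real.rpow_le_one_of_one_le_of_nonpos (by linarith [norm_nonneg y]) (by
      have : (0 : ℝ) ≤ d := Nat.cast_nonneg d
      linarith)
  have h4 : 0 ≤ (1 + ‖y‖) ^ (-(d + δ)) := by positivity
  have h5 : 0 ≤ ‖w y‖ ^ p := by positivity
  rw [norm_mul, Real.norm_of_nonneg h4]
  simp only [Pi.add_apply]
  nlinarith

lemma WeightIntegrable.sum {δ : ℝ} {k : ℕ} {w : Fin k → EuclideanSpace ℝ (Fin d) → ℝ}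
    (hw : ∀ i, WeightIntegrable δ (w i)) : WeightIntegrable δ fun x => ∑ i, w i x := by
  simp only [WeightIntegrable, Finset.sum_mul]
  exact integrable_finsetSum _ fun i _ => hw i

lemma WeightIntegrable.congr {δ : ℝ} {u v : EuclideanSpace ℝ (Fin d) → ℝ}
    (hu : WeightIntegrable δ u) (h : v =ᵐ[volume] u) : WeightIntegrable δ v :=
  Integrable.congr hu (by filter_upwards [h] with y hy; rw [hy])

/-- Hölder's inequality against a kernel of height `M a` and mass `M I`. -/
lemma abs_integral_mul_le_of_memLp {p : ℝ} (hp : 1 ≤ p)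
    {w : EuclideanSpace ℝ (Fin d) → ℝ} (hw : MemLp w (ENNReal.ofReal p) volume)
    {J : EuclideanSpace ℝ (Fin d) → ℝ} {M a I : ℝ} (ha : 0 < a)
    (hJ : Integrable J) (hJ1 : ∀ y, |J y| ≤ M * a) (hJ2 : ∫ y, |J y| ≤ M * I) :
    |∫ y, w y * J y| ≤ M * (I + 1) * a ^ (1 / p) *
      (eLpNorm w (ENNReal.ofReal p) volume).toReal := by
  have hp0 : 0 < p := by linarith
  have hpne : ENNReal.ofReal p ≠ 0 := by simpa using hp0
  set n := (eLpNorm w (ENNReal.ofReal p) volume).toReal with hn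
  have hn0 : 0 ≤ n := ENNReal.toReal_nonneg
  have h1 : Integrable fun y => ‖w y‖ ^ p := by
    have := hw.integrable_norm_rpow hpne ENNReal.ofReal_ne_top
    rwa [ENNReal.toReal_ofReal hp0.le] at this
  have hnp : ∫ y, ‖w y‖ ^ p = n ^ p := by
    rw [hn, hw.eLpNorm_eq_integral_rpow_norm hpne ENNReal.ofReal_ne_top,
      ENNReal.toReal_ofReal hp0.le, ENNReal.toReal_ofReal (by positivity),
      ← Real.rpow_mul (integral_nonneg fun _ => by positivity), inv_mul_cancel₀ hp0.ne',
      Real.rpow_one]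
  rcases hn0.eq_or_lt with hz | hpos
  · have : w =ᵐ[volume] 0 := by
      rw [← eLpNorm_eq_zero_iff hw.aestronglyMeasurable hpne]
      rcases (ENNReal.toReal_eq_zero_iff _).1 hz.symm with h | h
      · exact h
      · exact absurd h hw.eLpNorm_ne_top
    have h2 : ∫ y, w y * J y = 0 := by
      rw [← integral_zero (EuclideanSpace ℝ (Fin d)) ℝ]
      refine integral_congr_ae ?_
      filter_upwards [this] with y hy
      rw [hy]; simp
    rw [h2, ← hz]; simp
  · have hτ : 0 < a ^ (1 / p) * n := by positivity
    set τ := a ^ (1 / p) * n with hτdef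
    have hb : ∀ y, ‖w y * J y‖ ≤ τ * |J y| + τ ^ (1 - p) * (M * a) * ‖w y‖ ^ p := by
      intro y
      rw [norm_mul, Real.norm_eq_abs (J y)]
      calc ‖w y‖ * |J y| ≤ (τ + τ ^ (1 - p) * ‖w y‖ ^ p) * |J y| := by
            gcongr; exact abs_le_add_rpow hp hτ (norm_nonneg _)
        _ = τ * |J y| + τ ^ (1 - p) * ‖w y‖ ^ p * |J y| := by ring
        _ ≤ τ * |J y| + τ ^ (1 - p) * ‖w y‖ ^ p * (M * a) := by gcongr; exact hJ1 y
        _ = _ := by ring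
    have h2 := norm_integral_le_of_norm_le ((hJ.abs.const_mul τ).add
      (h1.const_mul (τ ^ (1 - p) * (M * a)))) (Filter.Eventually.of_forall hb)
    have h3 : ∫ y, ((fun y => τ * |J y|) + fun y => τ ^ (1 - p) * (M * a) * ‖w y‖ ^ p) y =
        τ * (∫ y, |J y|) + τ ^ (1 - p) * (M * a) * n ^ p := by
      rw [← hnp, ← integral_const_mul, ← integral_const_mul, ← integral_add]
      · rfl
      · exact hJ.abs.const_mul τ
      · exact h1.const_mul _
    have h4 : τ ^ (1 - p) * (M * a) * n ^ p = M * τ := by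
      have e : τ ^ p = a * n ^ p := by
        rw [hτdef, Real.mul_rpow (by positivity) hn0, ← Real.rpow_mul ha.le,
          one_div_mul_cancel hp0.ne', Real.rpow_one]
      have e2 : τ ^ (1 - p) * τ ^ p = τ := by rw [← Real.rpow_add hτ]; simp
      calc τ ^ (1 - p) * (M * a) * n ^ p = M * (τ ^ (1 - p) * (a * n ^ p)) := by ring
        _ = M * τ := by rw [← e, e2]
    calc |∫ y, w y * J y| ≤ τ * (∫ y, |J y|) + M * τ := by rw [← h4, ← h3]; exact h2
      _ ≤ τ * (M * I) + M * τ := by gcongr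
      _ = _ := by rw [hτdef]; ring

/-- The convolution `∫ u(y) K(x - y) dy`. -/
noncomputable def weightConv (u K : EuclideanSpace ℝ (Fin d) → ℝ) (x : EuclideanSpace ℝ (Fin d)) :
    ℝ := ∫ y, u y * K (x - y)

/-- For z in the unit ball about x the weight centred at z is dominated by a constant times the
weight centred at 0, so differentiation under the integral is dominated by the weighted |u|. -/
lemma hasFDerivAt_weightConv {δ : ℝ} (hδ : 0 < δ) {u K : EuclideanSpace ℝ (Fin d) → ℝ}
    (hu : WeightIntegrable δ u) (hK : SmoothDecay δ K) (x : EuclideanSpace ℝ (Fin d)) :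
    Integrable (fun y => u y • fderiv ℝ K (x - y)) ∧
    HasFDerivAt (weightConv u K) (∫ y, u y • fderiv ℝ K (x - y)) x := by
  have hq : (0 : ℝ) ≤ d + δ := by positivity
  have hKd : Continuous (fderiv ℝ K) := hK.contDiff.continuous_fderiv (by simp)
  have hKc : Continuous K := hK.contDiff.continuous
  obtain ⟨C0, hC0, h0⟩ := hK.decay []
  rw [iterPartial_nil] at h0
  choose C hC h using fun i => hK.decay [i]
  set D := ∑ i, C i * ‖(EuclideanSpace.proj i : EuclideanSpace ℝ (Fin d) →L[ℝ] ℝ)‖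
  have hD : ∀ z, ‖fderiv ℝ K z‖ ≤ D * (1 + ‖z‖) ^ (-(d + δ)) := by
    intro z
    rw [fderiv_eq_sum_partialDeriv, Finset.sum_mul]
    refine (norm_sum_le _ _).trans (Finset.sum_le_sum fun i _ => ?_)
    rw [norm_smul, Real.norm_eq_abs, mul_right_comm]
    gcongr
    exact h i z
  have hbd : ∀ z ∈ Metric.ball x 1, ∀ y, ‖u y • fderiv ℝ K (z - y)‖ ≤
      D * (2 + ‖x‖) ^ (d + δ) * ‖u y * (1 + ‖y‖) ^ (-(d + δ))‖ := by
    intro z hz y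
    have hz' : 1 + ‖z‖ ≤ 2 + ‖x‖ := by
      rw [Metric.mem_ball, dist_eq_norm] at hz
      have := norm_add_le x (z - x)
      rw [add_sub_cancel] at this
      linarith
    have hD0 : 0 ≤ D := Finset.sum_nonneg fun i _ => mul_nonneg (hC i) (norm_nonneg _)
    rw [norm_smul, norm_mul, Real.norm_of_nonneg (by positivity : 0 ≤ (1 + ‖y‖) ^ (-(d + δ)))]
    calc ‖u y‖ * ‖fderiv ℝ K (z - y)‖ ≤ ‖u y‖ * (D * ((2 + ‖x‖) ^ (d + δ) *
          (1 + ‖y‖) ^ (-(d + δ)))) := by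
          gcongr
          refine (hD _).trans ?_
          gcongr
          refine (weight_sub_le hq z y).trans ?_
          gcongr
      _ = _ := by ring
  have hmeas : AEStronglyMeasurable (fun y => u y • fderiv ℝ K (x - y)) :=
    hu.aestronglyMeasurable.smul (hKd.comp (by fun_prop)).aestronglyMeasurable
  refine ⟨(hu.norm.const_mul _).mono' hmeas
    (Filter.Eventually.of_forall (hbd x (Metric.mem_ball_self one_pos))), ?_⟩
  refine hasFDerivAt_integral_of_dominated_of_fderiv_le (𝕜 := ℝ) (F := fun x y => u y * K (x - y))
    (F' := fun x y => u y • fderiv ℝ K (x - y))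
    (bound := fun y => D * (2 + ‖x‖) ^ (d + δ) * ‖u y * (1 + ‖y‖) ^ (-(d + δ))‖)
    (Metric.ball_mem_nhds x one_pos) ?_ ?_ hmeas ?_ (hu.norm.const_mul _) ?_
  · filter_upwards with z
    exact hu.aestronglyMeasurable.mul (hKc.comp (by fun_prop)).aestronglyMeasurable
  · refine hu.integrable_mul (hKc.comp (by fun_prop)) (C := C0 * (1 + ‖x‖) ^ (d + δ)) fun y => ?_
    rw [mul_assoc]
    refine (h0 _).trans ?_
    gcongr
    exact weight_sub_le hq x y
  · filter_upwards with y z hz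
    exact hbd z hz y
  · filter_upwards with y z hz
    have h1 := (hK.contDiff.differentiable (by simp) (z - y)).hasFDerivAt.comp z
      ((hasFDerivAt_id z).sub_const y)
    exact h1.const_mul (u y)

lemma partialDeriv_weightConv {δ : ℝ} (hδ : 0 < δ) {u K : EuclideanSpace ℝ (Fin d) → ℝ}
    (hu : WeightIntegrable δ u) (hK : SmoothDecay δ K) (i : Fin d) :
    partialDeriv i (weightConv u K) = weightConv u (partialDeriv i K) := by
  ext x
  obtain ⟨h1, h2⟩ := hasFDerivAt_weightConv hδ hu hK x
  rw [partialDeriv, h2.fderiv, ContinuousLinearMap.integral_apply h1]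
  rfl

lemma iterPartial_weightConv {δ : ℝ} (hδ : 0 < δ) {u K : EuclideanSpace ℝ (Fin d) → ℝ}
    (hu : WeightIntegrable δ u) (hK : SmoothDecay δ K) (l : List (Fin d)) :
    iterPartial l (weightConv u K) = weightConv u (iterPartial l K) := by
  induction l with
  | nil => rfl
  | cons i l ih =>
    rw [iterPartial_cons, ih, partialDeriv_weightConv hδ hu (hK.iterPartial l), iterPartial_cons]

lemma contDiff_weightConv {δ : ℝ} (hδ : 0 < δ) {u K : EuclideanSpace ℝ (Fin d) → ℝ}
    (hu : WeightIntegrable δ u) (hK : SmoothDecay δ K) : ContDiff ℝ ∞ (weightConv u K) := by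
  refine contDiff_of_differentiable_iterPartial fun l x => ?_
  rw [iterPartial_weightConv hδ hu hK]
  exact (hasFDerivAt_weightConv hδ hu (hK.iterPartial l) x).2.differentiableAt

lemma iterPartial_comp_smul {f : EuclideanSpace ℝ (Fin d) → ℝ} (hf : ContDiff ℝ ∞ f) (c t : ℝ)
    (l : List (Fin d)) :
    iterPartial l (fun z => c * f (t • z)) = fun z => c * t ^ l.length * iterPartial l f (t • z) := by
  induction l with
  | nil => simp
  | cons i l ih =>
    ext z
    rw [iterPartial_cons, ih, partialDeriv]
    have h1 : HasFDerivAt (fun y : EuclideanSpace ℝ (Fin d) => t • y)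
        (t • ContinuousLinearMap.id ℝ _) z := (hasFDerivAt_id z).const_smul t
    have h2 := (((hf.iterPartial l).differentiable (by simp) (t • z)).hasFDerivAt.comp z h1).const_mul
      (c * t ^ l.length)
    have h3 := h2.fderiv
    simp only [Function.comp_def] at h3
    rw [h3]
    simp [pow_succ, partialDeriv]
    ring

lemma SmoothDecay.comp_smul {δ : ℝ} (hδ : 0 < δ) {f : EuclideanSpace ℝ (Fin d) → ℝ}
    (hf : SmoothDecay δ f) (c : ℝ) {t : ℝ} (ht : 0 < t) :
    SmoothDecay δ (fun z => c * f (t • z)) := by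
  refine ⟨contDiff_const.mul (hf.contDiff.comp (by fun_prop)), fun l => ?_⟩
  obtain ⟨C, hC, h⟩ := hf.decay l
  have hb : 0 < min 1 t := lt_min one_pos ht
  refine ⟨|c * t ^ l.length| * (C * (1 / min 1 t) ^ (d + δ)), by positivity, fun z => ?_⟩
  rw [iterPartial_comp_smul hf.contDiff, abs_mul, mul_assoc, mul_assoc]
  gcongr
  refine (h _).trans ?_
  gcongr
  have := weight_comp_le (q := d + δ) (by positivity) hb (min_le_left _ _) (min_le_right _ _) 0 (-z)
  simpa using this

end Weighted

/-! ### Dependence of the dilated average on the scale -/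

section Telescoping

variable {d : ℕ}

/-- The substitution t = Nλ moves the scale into the upper endpoint, so that differences between
scales become integrals over [M, N]. -/
lemma pow_mul_dilationAverage [NeZero d] (θ : EuclideanSpace ℝ (Fin d) → ℝ) (N : ℝ)
    (z : EuclideanSpace ℝ (Fin d)) :
    N ^ d * dilationAverage (d - 1) θ (N • z) = ∫ t in (0 : ℝ)..N, t ^ (d - 1) * θ (t • z) := by
  have hd : d = d - 1 + 1 := (Nat.succ_pred_eq_of_pos (NeZero.pos d)).symm
  have h := intervalIntegral.smul_integral_comp_mul_left (a := (0 : ℝ)) (b := 1)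
    (fun t : ℝ => t ^ (d - 1) * θ (t • z)) N
  rw [mul_zero, mul_one] at h
  rw [← h, dilationAverage, smul_eq_mul]
  have h2 : N ^ d = N * N ^ (d - 1) := by
    conv_lhs => rw [hd, pow_succ']
  rw [h2, mul_assoc, ← intervalIntegral.integral_const_mul]
  congr 2 with t
  rw [mul_pow, smul_smul, mul_comm t N, mul_assoc]

/-- The difference of the two dilates is the integral of t^(d-1) θ(tz) over [M, N]. Since t stays
away from 0, `weight_comp_le` dominates θ(t(x - y)) uniformly in t and Fubini applies. With u
`s`-harmonic the right side will vanish; with u a cosine it describes the Fourier transform of the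
average. -/
lemma integral_mul_comp_smul_sub_diff [NeZero d] {δ : ℝ} (hδ : 0 < δ)
    {u θ : EuclideanSpace ℝ (Fin d) → ℝ} (hu : WeightIntegrable δ u) (hθ : SmoothDecay δ θ)
    (hρ : SmoothDecay δ (dilationAverage (d - 1) θ)) {M N : ℝ} (hM : 0 < M) (hMN : M ≤ N)
    (x : EuclideanSpace ℝ (Fin d)) :
    (∫ y, u y * (N ^ d * dilationAverage (d - 1) θ (N • (x - y)))) -
      ∫ y, u y * (M ^ d * dilationAverage (d - 1) θ (M • (x - y))) =
      ∫ t in M..N, t ^ (d - 1) * ∫ y, u y * θ (t • (x - y)) := by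
  have hq : (0 : ℝ) ≤ d + δ := by positivity
  have hb : 0 < min 1 M := lt_min one_pos hM
  have hθc := hθ.contDiff.continuous
  obtain ⟨C, hC, h⟩ := hθ.decay []
  rw [iterPartial_nil] at h
  have hint : ∀ t : ℝ, 0 < t → Integrable fun y =>
      u y * (t ^ d * dilationAverage (d - 1) θ (t • (x - y))) := by
    intro t ht
    obtain ⟨C', hC', h'⟩ := (hρ.comp_smul hδ (t ^ d) ht).decay []
    rw [iterPartial_nil] at h'
    refine hu.integrable_mul (C := C' * (1 + ‖x‖) ^ (d + δ))
      ((hρ.comp_smul hδ (t ^ d) ht).contDiff.continuous.comp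
        (by fun_prop : Continuous fun y : EuclideanSpace ℝ (Fin d) => x - y)) fun y => ?_
    rw [mul_assoc]
    refine (h' _).trans ?_
    gcongr
    exact weight_sub_le hq x y
  have hswap : Integrable (Function.uncurry fun (t : ℝ) (y : EuclideanSpace ℝ (Fin d)) =>
      u y * (t ^ (d - 1) * θ (t • (x - y))))
      ((volume.restrict (Set.uIoc M N)).prod volume) := by
    have : IsFiniteMeasure (volume.restrict (Set.uIoc M N)) := by
      rw [Set.uIoc_of_le hMN]; infer_instance
    have h1 := (Integrable.comp_snd hu (volume.restrict (Set.uIoc M N))).norm.const_mul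
      (N ^ (d - 1) * C * ((1 + ‖x‖) / min 1 M) ^ (d + δ))
    refine h1.mono' ?_ ?_
    · exact hu.aestronglyMeasurable.comp_snd.mul (Continuous.aestronglyMeasurable (by fun_prop))
    · have : ∀ᵐ z ∂(volume.restrict (Set.uIoc M N)).prod
          (volume : Measure (EuclideanSpace ℝ (Fin d))), z.1 ∈ Set.uIoc M N :=
        Measure.quasiMeasurePreserving_fst.ae (ae_restrict_mem measurableSet_uIoc)
      filter_upwards [this] with z hz
      rw [Set.uIoc_of_le hMN] at hz
      have hz0 : 0 < z.1 := hM.trans hz.1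
      have hN0 : 0 < N := hM.trans_le hMN
      simp only [Function.uncurry]
      rw [norm_mul, norm_mul, norm_mul, norm_pow, Real.norm_of_nonneg hz0.le,
        Real.norm_eq_abs (θ _), Real.norm_of_nonneg (by positivity : 0 ≤ (1 + ‖z.2‖) ^ (-(d + δ)))]
      calc ‖u z.2‖ * (z.1 ^ (d - 1) * |θ (z.1 • (x - z.2))|)
          ≤ ‖u z.2‖ * (N ^ (d - 1) * (C * (((1 + ‖x‖) / min 1 M) ^ (d + δ) *
            (1 + ‖z.2‖) ^ (-(d + δ))))) := by
            gcongr
            · exact hz.2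
            · refine (h _).trans ?_
              gcongr
              exact weight_comp_le hq hb (min_le_left _ _) ((min_le_right _ _).trans hz.1.le) x z.2
        _ = _ := by ring
  rw [← integral_sub (hint N (hM.trans_le hMN)) (hint M hM)]
  simp_rw [← integral_const_mul]
  simp_rw [mul_left_comm]
  rw [intervalIntegral_integral_swap hswap]
  congr 1 with y
  rw [intervalIntegral.integral_const_mul, ← mul_sub,
    pow_mul_dilationAverage, pow_mul_dilationAverage, intervalIntegral.integral_interval_sub_left]
  · exact Continuous.intervalIntegrable (by fun_prop) _ _
  · exact Continuous.intervalIntegrable (by fun_prop) _ _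

end Telescoping

/-! ### Approximate identities -/

section ApproximateIdentity

variable {d : ℕ}

lemma integral_mul_dilate {g ρ : EuclideanSpace ℝ (Fin d) → ℝ} {N : ℝ} (hN : 0 < N)
    (y : EuclideanSpace ℝ (Fin d)) :
    ∫ x, g x * (N ^ d * ρ (N • (x - y))) = ∫ z, g (y + N⁻¹ • z) * ρ z := by
  have h := Measure.integral_comp_smul_of_nonneg (volume : Measure (EuclideanSpace ℝ (Fin d)))
    (fun z => g (y + N⁻¹ • z) * ρ z) N (hR := hN.le)
  rw [finrank_euclideanSpace_fin] at h
  have h2 : ∫ z, g (y + N⁻¹ • z) * ρ z = N ^ d * ∫ x, g (y + x) * ρ (N • x) := by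
    have h3 : ∫ x, g (y + x) * ρ (N • x) = (N ^ d)⁻¹ * ∫ z, g (y + N⁻¹ • z) * ρ z := by
      rw [← smul_eq_mul (N ^ d)⁻¹, ← h]
      congr 1 with x
      rw [smul_smul, inv_mul_cancel₀ hN.ne', one_smul]
    rw [h3, ← mul_assoc, mul_inv_cancel₀ (by positivity), one_mul]
  rw [h2, ← integral_const_mul,
    ← integral_sub_right_eq_self (fun x => N ^ d * (g (y + x) * ρ (N • x))) y]
  congr 1 with x
  rw [add_sub_cancel]
  ring

/-- A majorant independent of N, for dominated convergence against `u`. For bounded y the integral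
is at most sup|g| ∫|ρ|. For large y the points x in the support of g satisfy |x - y| ≥ (1 + |y|)/4,
and the factor N^d is absorbed by N^(-d-δ). -/
lemma exists_abs_integral_mul_dilate_le {δ : ℝ} (hδ : 0 < δ)
    {g ρ : EuclideanSpace ℝ (Fin d) → ℝ} (hg : IsTest g) (hρc : Continuous ρ) {C : ℝ}
    (hρ : ∀ x, |ρ x| ≤ C * (1 + ‖x‖) ^ (-(d + δ))) :
    ∃ C', ∀ N : ℝ, 1 ≤ N → ∀ y, |∫ x, g x * (N ^ d * ρ (N • (x - y)))| ≤
      C' * (1 + ‖y‖) ^ (-(d + δ)) := by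
  have hC : 0 ≤ C := by have := (abs_nonneg _).trans (hρ 0); simpa using this
  have hq : (0 : ℝ) ≤ d + δ := by positivity
  have hgc := hg.contDiff.continuous
  have hgi : Integrable g := hgc.integrable_of_hasCompactSupport hg.hasCompactSupport
  have hρi : Integrable ρ := ((integrable_weight hδ).const_mul C).mono' hρc.aestronglyMeasurable
    (Filter.Eventually.of_forall hρ)
  obtain ⟨a, ha0, ha⟩ := hg.hasCompactSupport.isBounded.exists_pos_norm_le
  obtain ⟨B, hB⟩ := hgc.bounded_above_of_compact_support hg.hasCompactSupport
  have hB0 : 0 ≤ B := (norm_nonneg _).trans (hB 0)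
  refine ⟨(2 * a + 2) ^ (d + δ) * (B * ∫ z, |ρ z|) + (C * 4 ^ (d + δ)) * ∫ x, |g x|,
    fun N hN y => ?_⟩
  have hN0 : 0 < N := by linarith
  have hI1 : 0 ≤ ∫ z, |ρ z| := integral_nonneg fun _ => abs_nonneg _
  have hI2 : 0 ≤ ∫ x, |g x| := integral_nonneg fun _ => abs_nonneg _
  have hy : 0 < 1 + ‖y‖ := by positivity
  have hw : 0 ≤ (1 + ‖y‖) ^ (-(d + δ)) := by positivity
  rw [add_mul]
  rcases le_total ‖y‖ (2 * a + 1) with h | h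
  · refine le_add_of_le_of_nonneg ?_ (by positivity)
    have h1 : |∫ z, g (y + N⁻¹ • z) * ρ z| ≤ B * ∫ z, |ρ z| := by
      rw [← integral_const_mul, ← Real.norm_eq_abs]
      refine norm_integral_le_of_norm_le (hρi.abs.const_mul B)
        (Filter.Eventually.of_forall fun z => ?_)
      rw [norm_mul, Real.norm_eq_abs (ρ z)]
      gcongr
      exact hB _
    have h2 : 1 ≤ (2 * a + 2) ^ (d + δ) * (1 + ‖y‖) ^ (-(d + δ)) := by
      rw [Real.rpow_neg hy.le, ← div_eq_mul_inv, one_le_div (by positivity)]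
      exact Real.rpow_le_rpow hy.le (by linarith) hq
    rw [integral_mul_dilate hN0]
    calc _ ≤ (B * ∫ z, |ρ z|) * ((2 * a + 2) ^ (d + δ) * (1 + ‖y‖) ^ (-(d + δ))) :=
          h1.trans (le_mul_of_one_le_right (by positivity) h2)
      _ = _ := by ring
  · refine le_add_of_nonneg_of_le (by positivity) ?_
    rw [mul_right_comm, ← integral_const_mul, ← Real.norm_eq_abs]
    refine norm_integral_le_of_norm_le (hgi.abs.const_mul _)
      (Filter.Eventually.of_forall fun x => ?_)
    rw [norm_mul, Real.norm_eq_abs, mul_comm]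
    by_cases hx : g x = 0
    · simp [hx]
    gcongr
    have hxa : ‖x‖ ≤ a := ha x (subset_tsupport _ hx)
    have h3 : (1 + ‖y‖) / 4 ≤ ‖x - y‖ := by
      have := norm_sub_le x (x - y)
      rw [sub_sub_cancel] at this
      linarith
    rw [norm_mul, norm_pow, Real.norm_of_nonneg hN0.le, Real.norm_eq_abs]
    calc N ^ d * |ρ (N • (x - y))| ≤ N ^ d * (C * (N * ((1 + ‖y‖) / 4)) ^ (-(d + δ))) := by
          gcongr
          refine (hρ _).trans ?_
          gcongr C * ?_
          refine Real.rpow_le_rpow_of_nonpos (by positivity) ?_ (by linarith)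
          rw [norm_smul, Real.norm_of_nonneg hN0.le]
          have : N * ((1 + ‖y‖) / 4) ≤ N * ‖x - y‖ := by gcongr
          linarith
      _ = C * 4 ^ (d + δ) * (1 + ‖y‖) ^ (-(d + δ)) * (N ^ (d : ℝ) * N ^ (-(d + δ))) := by
          rw [Real.mul_rpow hN0.le (by positivity), Real.div_rpow hy.le (by norm_num),
            Real.rpow_neg (by norm_num : (0 : ℝ) ≤ 4), Real.rpow_natCast, div_inv_eq_mul]
          ring
      _ ≤ C * 4 ^ (d + δ) * (1 + ‖y‖) ^ (-(d + δ)) * 1 := by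
          gcongr
          rw [← Real.rpow_add hN0]
          exact Real.rpow_le_one_of_one_le_of_nonpos hN (by linarith)
      _ = _ := mul_one _

lemma tendsto_integral_mul_dilate {g ρ : EuclideanSpace ℝ (Fin d) → ℝ} (hg : IsTest g)
    (hρ : Integrable ρ) (y : EuclideanSpace ℝ (Fin d)) :
    Filter.Tendsto (fun n : ℕ => ∫ x, g x * (((n : ℝ) + 1) ^ d * ρ (((n : ℝ) + 1) • (x - y))))
      Filter.atTop (nhds (g y * ∫ z, ρ z)) := by
  have hgc := hg.contDiff.continuous
  obtain ⟨B, hB⟩ := hgc.bounded_above_of_compact_support hg.hasCompactSupport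
  have h1 : ∀ n : ℕ, (0 : ℝ) < (n : ℝ) + 1 := fun n => by positivity
  simp only [fun n : ℕ => integral_mul_dilate (g := g) (ρ := ρ) (h1 n) y]
  rw [← integral_const_mul]
  refine tendsto_integral_of_dominated_convergence (fun z => B * |ρ z|) (fun n => ?_)
    (hρ.abs.const_mul B) (fun n => Filter.Eventually.of_forall fun z => ?_)
    (Filter.Eventually.of_forall fun z => ?_)
  · exact (hgc.comp (by fun_prop)).aestronglyMeasurable.mul hρ.aestronglyMeasurable
  · rw [norm_mul, Real.norm_eq_abs (ρ z)]
    gcongr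
    exact hB _
  · refine Filter.Tendsto.mul_const _ ?_
    have h2 : Filter.Tendsto (fun n : ℕ => y + ((n : ℝ) + 1)⁻¹ • z) Filter.atTop (nhds y) := by
      have h3 : Filter.Tendsto (fun n : ℕ => ((n : ℝ) + 1)⁻¹) Filter.atTop (nhds 0) := by
        simpa only [one_div] using tendsto_one_div_add_atTop_nhds_zero_nat (𝕜 := ℝ)
      simpa using (h3.smul_const z).const_add y
    exact (hgc.tendsto y).comp h2

lemma integral_integral_mul_dilate_swap {δ : ℝ} (hδ : 0 < δ)
    {u g ρ : EuclideanSpace ℝ (Fin d) → ℝ} (hu : WeightIntegrable δ u)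
    (hg : IsTest g) (hρc : Continuous ρ) {C : ℝ}
    (hρ : ∀ x, |ρ x| ≤ C * (1 + ‖x‖) ^ (-(d + δ))) {N : ℝ} (hN : 1 ≤ N) :
    ∫ x, g x * ∫ y, u y * (N ^ d * ρ (N • (x - y))) =
      ∫ y, u y * ∫ x, g x * (N ^ d * ρ (N • (x - y))) := by
  have hgc := hg.contDiff.continuous
  have hN0 : 0 < N := by linarith
  have hq : (0 : ℝ) ≤ d + δ := by positivity
  simp_rw [← integral_const_mul]
  rw [integral_integral_swap]
  · simp_rw [mul_left_comm]
  have hgi : Integrable fun x => g x * (1 + ‖x‖) ^ (d + δ) :=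
    (hgc.mul (continuous_one_add_norm_rpow _)).integrable_of_hasCompactSupport
      hg.hasCompactSupport.mul_right
  refine ((hgi.norm.mul_prod hu.norm).const_mul (N ^ d * C)).mono' ?_ ?_
  · simp only [Function.uncurry_def]
    refine (hgc.comp continuous_fst).aestronglyMeasurable.mul
      (hu.aestronglyMeasurable.comp_snd.mul (Continuous.aestronglyMeasurable (by fun_prop)))
  · filter_upwards with z
    simp only [Function.uncurry]
    simp only [norm_mul, norm_pow, Real.norm_of_nonneg hN0.le, Real.norm_eq_abs (ρ _),
      Real.norm_of_nonneg (by positivity : 0 ≤ (1 + ‖z.2‖) ^ (-(d + δ))),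
      Real.norm_of_nonneg (by positivity : 0 ≤ (1 + ‖z.1‖) ^ (d + δ))]
    calc ‖g z.1‖ * (‖u z.2‖ * (N ^ d * |ρ (N • (z.1 - z.2))|))
        ≤ ‖g z.1‖ * (‖u z.2‖ * (N ^ d * (C * ((1 + ‖z.1‖) ^ (d + δ) *
          (1 + ‖z.2‖) ^ (-(d + δ)))))) := by
          have hC : 0 ≤ C := by have := (abs_nonneg _).trans (hρ 0); simpa using this
          gcongr
          refine (hρ _).trans ?_
          gcongr
          simpa using weight_comp_le hq one_pos le_rfl hN z.1 z.2
      _ = _ := by ring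

/-- Dilations of an integrable, sufficiently decaying kernel form an approximate identity, tested
against smooth functions. -/
lemma tendsto_integral_mul_integral_dilate {δ : ℝ} (hδ : 0 < δ)
    {u g ρ : EuclideanSpace ℝ (Fin d) → ℝ} (hu : WeightIntegrable δ u)
    (hg : IsTest g) (hρc : Continuous ρ) {C : ℝ}
    (hρ : ∀ x, |ρ x| ≤ C * (1 + ‖x‖) ^ (-(d + δ))) :
    Filter.Tendsto (fun n : ℕ => ∫ x, g x *
        ∫ y, u y * (((n : ℝ) + 1) ^ d * ρ (((n : ℝ) + 1) • (x - y))))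
      Filter.atTop (nhds (∫ y, u y * (g y * ∫ z, ρ z))) := by
  have h1 : ∀ n : ℕ, (1 : ℝ) ≤ (n : ℝ) + 1 := fun n => by linarith [n.cast_nonneg (α := ℝ)]
  simp only [fun n : ℕ => integral_integral_mul_dilate_swap hδ hu hg hρc hρ (h1 n)]
  obtain ⟨C', hC'⟩ := exists_abs_integral_mul_dilate_le hδ hg hρc hρ
  have hρi : Integrable ρ := ((integrable_weight hδ).const_mul C).mono' hρc.aestronglyMeasurable
    (Filter.Eventually.of_forall hρ)
  have hgc := hg.contDiff.continuous
  have hgi : Integrable g := hgc.integrable_of_hasCompactSupport hg.hasCompactSupport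
  refine tendsto_integral_of_dominated_convergence (fun y => C' * ‖u y * (1 + ‖y‖) ^ (-(d + δ))‖)
    (fun n => ?_) (hu.norm.const_mul C') (fun n => Filter.Eventually.of_forall fun y => ?_)
    (Filter.Eventually.of_forall fun y => (tendsto_integral_mul_dilate hg hρi y).const_mul _)
  · refine hu.aestronglyMeasurable.mul (AEStronglyMeasurable.integral_prod_right'
      (f := fun z : EuclideanSpace ℝ (Fin d) × EuclideanSpace ℝ (Fin d) =>
        g z.2 * (((n : ℝ) + 1) ^ d * ρ (((n : ℝ) + 1) • (z.2 - z.1)))) ?_)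
    exact Continuous.aestronglyMeasurable (by fun_prop)
  · rw [norm_mul, norm_mul, Real.norm_of_nonneg (by positivity : 0 ≤ (1 + ‖y‖) ^ (-(d + δ))),
      mul_left_comm]
    gcongr
    exact hC' _ (h1 n) y

end ApproximateIdentity

/-! ### A radial bump with nonnegative Fourier transform -/

section RadialBump

variable {d : ℕ}

/-- A radial bump function supported in the ball of radius `1/2`. -/
noncomputable def radialBump (d : ℕ) (x : EuclideanSpace ℝ (Fin d)) : ℝ :=
  Real.smoothTransition (1 - 4 * ‖x‖ ^ 2)

lemma radialBump_nonneg (x : EuclideanSpace ℝ (Fin d)) : 0 ≤ radialBump d x :=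
  Real.smoothTransition.nonneg _

lemma radialBump_eq_zero {x : EuclideanSpace ℝ (Fin d)} (hx : 1 / 2 ≤ ‖x‖) :
    radialBump d x = 0 :=
  Real.smoothTransition.zero_of_nonpos (by nlinarith)

lemma isTest_radialBump : IsTest (radialBump d) := by
  refine ⟨Real.smoothTransition.contDiff.comp
    (contDiff_const.sub (contDiff_const.mul (contDiff_norm_sq ℝ))), ?_⟩
  refine HasCompactSupport.intro (isCompact_closedBall 0 (1 / 2)) fun x hx => ?_
  rw [mem_closedBall_zero_iff, not_le] at hx
  exact radialBump_eq_zero hx.le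

lemma radialBump_comp_isometry (A : EuclideanSpace ℝ (Fin d) ≃ₗᵢ[ℝ] EuclideanSpace ℝ (Fin d))
    (x : EuclideanSpace ℝ (Fin d)) : radialBump d (A x) = radialBump d x := by
  simp [radialBump]

lemma integrable_exp_smul {f : EuclideanSpace ℝ (Fin d) → ℝ} (hfi : Integrable f)
    (ξ : EuclideanSpace ℝ (Fin d)) : Integrable fun v : EuclideanSpace ℝ (Fin d) =>
      Complex.exp (↑(-2 * Real.pi * inner ℝ v ξ) * Complex.I) • (f v : ℂ) := by
  have hc : Continuous fun v : EuclideanSpace ℝ (Fin d) =>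
      Complex.exp (↑(-2 * Real.pi * inner ℝ v ξ) * Complex.I) := by fun_prop
  refine hfi.norm.mono' (hc.aestronglyMeasurable.smul
    (Complex.continuous_ofReal.comp_aestronglyMeasurable hfi.aestronglyMeasurable))
    (Filter.Eventually.of_forall fun v => ?_)
  rw [norm_smul, Complex.norm_exp_ofReal_mul_I, one_mul, Complex.norm_real]

lemma fourier_im_eq_zero_of_even {f : EuclideanSpace ℝ (Fin d) → ℝ} (hf : ∀ x, f (-x) = f x)
    (hfi : Integrable f) (ξ : EuclideanSpace ℝ (Fin d)) : (𝓕 (fun x => (f x : ℂ)) ξ).im = 0 := by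
  have h1 := integrable_exp_smul hfi ξ
  rw [Real.fourier_eq', ← Complex.imCLM_apply, ← Complex.imCLM.integral_comp_comm h1]
  have h2 : ∀ v, Complex.imCLM (Complex.exp (↑(-2 * Real.pi * inner ℝ v ξ) * Complex.I) • (f v : ℂ))
      = Real.sin (-2 * Real.pi * inner ℝ v ξ) * f v := by
    intro v
    rw [Complex.imCLM_apply, smul_eq_mul, Complex.im_mul_ofReal, Complex.exp_ofReal_mul_I_im]
  simp only [h2]
  have h3 := integral_neg_eq_self
    (fun v : EuclideanSpace ℝ (Fin d) => Real.sin (-2 * Real.pi * inner ℝ v ξ) * f v) volume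
  simp only [hf, inner_neg_left, mul_neg, Real.sin_neg, neg_mul, neg_neg] at h3
  rw [integral_neg] at h3
  simp only [neg_mul, Real.sin_neg, integral_neg]
  linarith

lemma integral_cos_mul_eq_re_fourier {f : EuclideanSpace ℝ (Fin d) → ℝ}
    (hfi : Integrable f) (ξ : EuclideanSpace ℝ (Fin d)) :
    ∫ v, Real.cos (2 * Real.pi * inner ℝ ξ v) * f v = (𝓕 (fun x => (f x : ℂ)) ξ).re := by
  have h1 := integrable_exp_smul hfi ξ
  rw [Real.fourier_eq', ← Complex.reCLM_apply, ← Complex.reCLM.integral_comp_comm h1]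
  congr 1 with v
  rw [Complex.reCLM_apply, smul_eq_mul, Complex.re_mul_ofReal, Complex.exp_ofReal_mul_I_re,
    ← Real.cos_neg, real_inner_comm]
  congr 2; ring

/-- The autocorrelation of `radialBump`: a radial test function with nonnegative Fourier
transform. -/
noncomputable def bumpSq (d : ℕ) : EuclideanSpace ℝ (Fin d) → ℝ :=
  convolution (radialBump d) (radialBump d) (ContinuousLinearMap.mul ℝ ℝ) volume

lemma bumpSq_apply (x : EuclideanSpace ℝ (Fin d)) :
    bumpSq d x = ∫ t, radialBump d t * radialBump d (x - t) := rfl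

lemma isTest_bumpSq : IsTest (bumpSq d) := by
  have h := isTest_radialBump (d := d)
  exact ⟨h.hasCompactSupport.contDiff_convolution_right _
    h.contDiff.continuous.locallyIntegrable h.contDiff,
    h.hasCompactSupport.convolution _ h.hasCompactSupport⟩

lemma bumpSq_comp_isometry (A : EuclideanSpace ℝ (Fin d) ≃ₗᵢ[ℝ] EuclideanSpace ℝ (Fin d))
    (x : EuclideanSpace ℝ (Fin d)) : bumpSq d (A x) = bumpSq d x := by
  rw [bumpSq_apply, bumpSq_apply,
    ← A.measurePreserving.integral_comp A.toHomeomorph.measurableEmbedding]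
  simp only [← map_sub, radialBump_comp_isometry]

lemma bumpSq_eq_zero {x : EuclideanSpace ℝ (Fin d)} (hx : 1 ≤ ‖x‖) : bumpSq d x = 0 := by
  rw [bumpSq_apply, ← integral_zero (EuclideanSpace ℝ (Fin d)) ℝ]
  congr 1 with t
  rcases le_total (1 / 2) ‖t‖ with h | h
  · rw [radialBump_eq_zero h, zero_mul]
  · rw [radialBump_eq_zero (x := x - t), mul_zero]
    have := norm_sub_norm_le x t
    linarith

/-- The transform of a convolution square is a square, and the transform of the real even bump is
real, so the square is nonnegative. -/
lemma fourier_bumpSq (ξ : EuclideanSpace ℝ (Fin d)) :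
    𝓕 (fun x => (bumpSq d x : ℂ)) ξ =
      (((𝓕 (fun x => (radialBump d x : ℂ)) ξ).re ^ 2 : ℝ) : ℂ) := by
  have hi : Integrable fun x => (radialBump d x : ℂ) := isTest_radialBump.schwartz.integrable
  have h1 : (fun x => (bumpSq d x : ℂ)) = convolution (fun x => (radialBump d x : ℂ))
      (fun x => (radialBump d x : ℂ)) (ContinuousLinearMap.mul ℂ ℂ) volume := by
    ext x
    rw [bumpSq_apply, ← integral_complex_ofReal]
    simp [convolution]
  rw [h1, Real.fourier_mul_convolution_eq hi hi]
  have h2 : (𝓕 (fun x => (radialBump d x : ℂ)) ξ).im = 0 :=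
    fourier_im_eq_zero_of_even (fun x => by simp [radialBump])
      (isTest_radialBump.contDiff.continuous.integrable_of_hasCompactSupport
        isTest_radialBump.hasCompactSupport) ξ
  apply Complex.ext <;> simp [h2, sq]

lemma re_fourier_bumpSq_nonneg (ξ : EuclideanSpace ℝ (Fin d)) :
    0 ≤ (𝓕 (fun x => (bumpSq d x : ℂ)) ξ).re := by
  rw [fourier_bumpSq, Complex.ofReal_re]; positivity

lemma re_fourier_bumpSq_zero_pos : 0 < (𝓕 (fun x => (bumpSq d x : ℂ)) 0).re := by
  have hi : Integrable (radialBump d) :=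
    isTest_radialBump.contDiff.continuous.integrable_of_hasCompactSupport
      isTest_radialBump.hasCompactSupport
  rw [fourier_bumpSq, Complex.ofReal_re, ← integral_cos_mul_eq_re_fourier hi]
  simp only [inner_zero_left, mul_zero, Real.cos_zero, one_mul]
  have : 0 < ∫ v, radialBump d v :=
    isTest_radialBump.contDiff.continuous.integral_pos_of_hasCompactSupport_nonneg_nonzero
      isTest_radialBump.hasCompactSupport radialBump_nonneg (x := 0) (by simp [radialBump])
  positivity

end RadialBump

/-! ### The parametrix and the positivity of its integral -/

section Profile

variable {d : ℕ}

lemma integrable_fracLap [NeZero d] {s : ℝ} (hs : 0 < s) {f : EuclideanSpace ℝ (Fin d) → ℝ}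
    (hf : IsTest f) : Integrable (fracLap s f) := by
  obtain ⟨C, hC, h⟩ := exists_abs_fracLap_le hs hf
  have hc : Continuous (fracLap s f) := (smoothDecay_fracLap hs le_rfl hf).contDiff.continuous
  exact ((integrable_weight (by positivity : 0 < 2 * s)).const_mul C).mono' hc.aestronglyMeasurable
    (Filter.Eventually.of_forall h)

lemma fourier_fracLap [NeZero d] {s : ℝ} (hs : 0 < s) {f : EuclideanSpace ℝ (Fin d) → ℝ}
    (hf : IsTest f) (ξ : EuclideanSpace ℝ (Fin d)) :
    𝓕 (fun x => (fracLap s f x : ℂ)) ξ =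
      (((2 * Real.pi * ‖ξ‖) ^ (2 * s) : ℝ) : ℂ) * 𝓕 (fun x => (f x : ℂ)) ξ := by
  set g : EuclideanSpace ℝ (Fin d) → ℂ := fun ξ => (((2 * Real.pi * ‖ξ‖) ^ (2 * s) : ℝ) : ℂ) *
      𝓕 (fun x => (f x : ℂ)) ξ with hg
  have hgc : Continuous g := by
    have h1 : Continuous fun ξ : EuclideanSpace ℝ (Fin d) => (2 * Real.pi * ‖ξ‖) ^ (2 * s) :=
      (by fun_prop : Continuous fun ξ : EuclideanSpace ℝ (Fin d) =>
        2 * Real.pi * ‖ξ‖).rpow_const fun _ => Or.inr (by positivity)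
    exact (Complex.continuous_ofReal.comp h1).mul hf.continuous_fourier
  have hgi : Integrable g := by
    refine ((hf.integrable_rpow_mul_fourier (a := 2 * s) (by positivity)).const_mul
      ((2 * Real.pi) ^ (2 * s))).mono' hgc.aestronglyMeasurable
      (Filter.Eventually.of_forall fun ξ => le_of_eq ?_)
    rw [hg]
    simp only
    rw [norm_mul, Complex.norm_real, Real.norm_of_nonneg (by positivity),
      Real.mul_rpow Real.two_pi_pos.le (norm_nonneg _), mul_assoc]
  have h1 : (fun x => (fracLap s f x : ℂ)) = 𝓕⁻ g := by
    ext x; rw [← fracLaplacian_eq_ofReal hs hf]; rfl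
  have h2 : 𝓕 g = fun x => (fracLap s f (-x) : ℂ) := by
    ext x
    rw [congrFun h1 (-x), Real.fourierInv_eq_fourier_neg, neg_neg]
  have h3 : Integrable (𝓕 g) := by
    rw [h2]; exact (integrable_fracLap hs hf).comp_neg.ofReal
  rw [h1, hgc.fourier_fourierInv_eq hgi h3]

/-- The integral is the Fourier transform at 0, where the symbol |ξ|^(2s) vanishes. -/
lemma integral_fracLap_eq_zero [NeZero d] {s : ℝ} (hs : 0 < s)
    {f : EuclideanSpace ℝ (Fin d) → ℝ} (hf : IsTest f) : ∫ x, fracLap s f x = 0 := by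
  have h1 := integral_cos_mul_eq_re_fourier (integrable_fracLap hs hf) 0
  rw [fourier_fracLap hs hf] at h1
  simpa [Real.zero_rpow (by positivity : 2 * s ≠ 0)] using h1

lemma fracLap_bumpSq_radial [NeZero d] {s : ℝ} (hs : 0 < s) (x y : EuclideanSpace ℝ (Fin d))
    (h : ‖x‖ = ‖y‖) : fracLap s (bumpSq d) x = fracLap s (bumpSq d) y := by
  obtain ⟨A, rfl⟩ := exists_linearIsometryEquiv_map_eq h
  exact (fracLap_comp_isometry hs isTest_bumpSq A (bumpSq_comp_isometry A) x).symm

/-- The kernel `∫₀¹ λ^{d-1} ((-Δ)^s η)(λ x) dλ` with `η = bumpSq d`. -/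
noncomputable def parametrix (d : ℕ) (s : ℝ) : EuclideanSpace ℝ (Fin d) → ℝ :=
  dilationAverage (d - 1) (fracLap s (bumpSq d))

lemma smoothDecay_parametrix [NeZero d] {s δ : ℝ} (hs : 0 < s) (hδ0 : 0 < δ) (hδ1 : δ < 1)
    (hδ : δ ≤ 2 * s) : SmoothDecay δ (parametrix d s) :=
  smoothDecay_dilationAverage hδ0 hδ1 (smoothDecay_fracLap hs hδ isTest_bumpSq)
    (fracLap_bumpSq_radial hs) (integrable_fracLap hs isTest_bumpSq)
    (integral_fracLap_eq_zero hs isTest_bumpSq)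

lemma SmoothDecay.integrable {δ : ℝ} (hδ : 0 < δ) {f : EuclideanSpace ℝ (Fin d) → ℝ}
    (hf : SmoothDecay δ f) : Integrable f := by
  obtain ⟨C, hC, h⟩ := hf.decay []
  exact ((integrable_weight hδ).const_mul C).mono' hf.contDiff.continuous.aestronglyMeasurable
    (Filter.Eventually.of_forall h)

lemma integral_cos_mul_dilate {f : EuclideanSpace ℝ (Fin d) → ℝ} (hf : Integrable f)
    (ξ : EuclideanSpace ℝ (Fin d)) {t : ℝ} (ht : 0 < t) :
    ∫ y, Real.cos (2 * Real.pi * inner ℝ ξ y) * (t ^ d * f (t • (0 - y))) =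
      (𝓕 (fun x => (f x : ℂ)) (t⁻¹ • ξ)).re := by
  rw [← integral_cos_mul_eq_re_fourier hf]
  have h := Measure.integral_comp_smul (volume : Measure (EuclideanSpace ℝ (Fin d)))
    (fun v => Real.cos (2 * Real.pi * inner ℝ (t⁻¹ • ξ) v) * f v) (-t)
  rw [finrank_euclideanSpace_fin, abs_inv, abs_pow, abs_neg, abs_of_pos ht, smul_eq_mul,
    eq_inv_mul_iff_mul_eq₀ (by positivity)] at h
  rw [← h, ← integral_const_mul]
  congr 1 with y
  rw [inner_smul_left, inner_smul_right, RCLike.conj_to_real]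
  have h2 : 2 * Real.pi * (t⁻¹ * (-t * inner ℝ ξ y)) = -(2 * Real.pi * inner ℝ ξ y) := by
    field_simp
  rw [h2, Real.cos_neg, zero_sub, smul_neg, neg_smul]
  ring

/-- Telescoping against the cosine with frequency `e` gives the increments of the transform P of the
parametrix along the ray: P(e/N) - P(e/M) is the integral over [M, N] of t⁻¹ times the transform of
(-Δ)^s η at e/t, which is nonnegative. Thus P decreases away from the origin to its limit 0 at
infinity (Riemann–Lebesgue), and it does so strictly somewhere, because the transform of η is
positive near 0. Hence P(0), the integral sought, is positive. -/
lemma integral_parametrix_pos [NeZero d] {s : ℝ} (hs : 0 < s) : 0 < ∫ x, parametrix d s x := by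
  obtain ⟨δ, hδ0, hδ1, hδ⟩ : ∃ δ : ℝ, 0 < δ ∧ δ < 1 ∧ δ ≤ 2 * s :=
    ⟨min s (1 / 2), by positivity, (min_le_right _ _).trans_lt (by norm_num),
      (min_le_left _ _).trans (by linarith)⟩
  have hρ := smoothDecay_parametrix (d := d) hs hδ0 hδ1 hδ
  have hθ : SmoothDecay δ (fracLap s (bumpSq d)) := smoothDecay_fracLap hs hδ isTest_bumpSq
  have hρi := hρ.integrable hδ0
  obtain ⟨e, hne⟩ : ∃ e : EuclideanSpace ℝ (Fin d), ‖e‖ = 1 :=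
    ⟨EuclideanSpace.single 0 1, by simp⟩
  set P : EuclideanSpace ℝ (Fin d) → ℝ := fun ξ => (𝓕 (fun x => (parametrix d s x : ℂ)) ξ).re
    with hP
  set H : EuclideanSpace ℝ (Fin d) → ℝ := fun ξ => (𝓕 (fun x => (bumpSq d x : ℂ)) ξ).re
    with hH
  have hHc : Continuous H := Complex.continuous_re.comp isTest_bumpSq.continuous_fourier
  have hdiff : ∀ M N : ℝ, 0 < M → M ≤ N → P (N⁻¹ • e) - P (M⁻¹ • e) =
      ∫ t in M..N, t⁻¹ * ((2 * Real.pi * ‖t⁻¹ • e‖) ^ (2 * s) * H (t⁻¹ • e)) := by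
    intro M N hM hMN
    have hcos : WeightIntegrable δ fun y : EuclideanSpace ℝ (Fin d) =>
        Real.cos (2 * Real.pi * inner ℝ e y) :=
      WeightIntegrable.of_bounded hδ0 (Continuous.aestronglyMeasurable (by fun_prop))
        (C := 1) fun y => Real.abs_cos_le_one _
    have h1 := integral_mul_comp_smul_sub_diff hδ0 hcos hθ hρ hM hMN 0
    change (∫ y, Real.cos (2 * Real.pi * inner ℝ e y) * (N ^ d * parametrix d s (N • (0 - y)))) -
      (∫ y, Real.cos (2 * Real.pi * inner ℝ e y) * (M ^ d * parametrix d s (M • (0 - y)))) = _ at h1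
    rw [integral_cos_mul_dilate hρi e hM, integral_cos_mul_dilate hρi e (hM.trans_le hMN)] at h1
    refine h1.trans (intervalIntegral.integral_congr fun t ht => ?_)
    rw [Set.uIcc_of_le hMN] at ht
    have ht0 : 0 < t := hM.trans_le ht.1
    have h2 := integral_cos_mul_dilate (integrable_fracLap hs (isTest_bumpSq (d := d))) e ht0
    rw [fourier_fracLap hs isTest_bumpSq, Complex.re_ofReal_mul] at h2
    have hd : d = d - 1 + 1 := (Nat.succ_pred_eq_of_pos (NeZero.pos d)).symm
    have h3 : t ^ (d - 1) = t⁻¹ * t ^ d := by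
      conv_rhs => rw [hd, pow_succ]
      field_simp
    rw [h3, mul_assoc, ← h2, ← integral_const_mul]
    congr 2 with y
    ring
  have hnn : ∀ t : ℝ, 0 < t → 0 ≤ t⁻¹ * ((2 * Real.pi * ‖t⁻¹ • e‖) ^ (2 * s) * H (t⁻¹ • e)) := by
    intro t ht
    have := re_fourier_bumpSq_nonneg (t⁻¹ • e)
    simp only [hH]
    positivity
  have hmono : ∀ M N : ℝ, 0 < M → M ≤ N → P (M⁻¹ • e) ≤ P (N⁻¹ • e) := by
    intro M N hM hMN
    rw [← sub_nonneg, hdiff M N hM hMN]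
    exact intervalIntegral.integral_nonneg hMN fun t ht => hnn t (hM.trans_le ht.1)
  have hlim0 : Filter.Tendsto (fun n : ℕ => P ((n : ℝ) • e)) Filter.atTop (nhds 0) := by
    have h1 := tendsto_integral_exp_inner_smul_cocompact
      (fun x : EuclideanSpace ℝ (Fin d) => (parametrix d s x : ℂ))
    have h2 : Filter.Tendsto (fun n : ℕ => (n : ℝ) • e) Filter.atTop
        (Filter.cocompact (EuclideanSpace ℝ (Fin d))) := by
      rw [← Metric.cobounded_eq_cocompact, ← tendsto_norm_atTop_iff_cobounded]
      simp only [norm_smul, hne, mul_one, Real.norm_natCast]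
      exact tendsto_natCast_atTop_atTop
    have h3 := (Complex.continuous_re.tendsto 0).comp (h1.comp h2)
    exact h3
  have hPc : Continuous P := by
    simp only [hP, ← integral_cos_mul_eq_re_fourier hρi]
    refine continuous_of_dominated (fun ξ => ?_)
      (fun ξ => Filter.Eventually.of_forall fun v => ?_) hρi.norm
      (Filter.Eventually.of_forall fun v => by fun_prop)
    · have hc : Continuous fun v : EuclideanSpace ℝ (Fin d) =>
          Real.cos (2 * Real.pi * inner ℝ ξ v) := by fun_prop
      exact hc.aestronglyMeasurable.mul hρi.aestronglyMeasurable
    · rw [norm_mul]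
      exact mul_le_of_le_one_left (norm_nonneg _) (Real.abs_cos_le_one _)
  have hlim1 : Filter.Tendsto (fun n : ℕ => P (((n : ℝ) + 1)⁻¹ • e)) Filter.atTop (nhds (P 0)) := by
    have h3 : Filter.Tendsto (fun n : ℕ => ((n : ℝ) + 1)⁻¹) Filter.atTop (nhds 0) := by
      simpa only [one_div] using tendsto_one_div_add_atTop_nhds_zero_nat (𝕜 := ℝ)
    refine (hPc.tendsto 0).comp ?_
    simpa using h3.smul_const e
  have hP0 : P 0 = ∫ x, parametrix d s x := by
    simp only [hP, ← integral_cos_mul_eq_re_fourier hρi]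
    simp
  rw [← hP0]
  have hupper : ∀ M : ℝ, 0 < M → P (M⁻¹ • e) ≤ P 0 := by
    intro M hM
    refine ge_of_tendsto hlim1 ?_
    filter_upwards [Filter.eventually_ge_atTop ⌈M⌉₊] with n hn
    refine hmono _ _ hM ?_
    have := (Nat.le_ceil M).trans (Nat.cast_le.2 hn)
    linarith
  have hlower : ∀ M : ℝ, 0 < M → 0 ≤ P (M⁻¹ • e) := by
    intro M hM
    refine le_of_tendsto hlim0 ?_
    filter_upwards [Filter.eventually_ge_atTop (⌈M⁻¹⌉₊ + 1)] with n hn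
    have hn0 : (0 : ℝ) < n := by exact_mod_cast (by omega : 0 < n)
    have h1 : M⁻¹ ≤ n := (Nat.le_ceil _).trans (by exact_mod_cast (by omega : ⌈M⁻¹⌉₊ ≤ n))
    have := hmono (n : ℝ)⁻¹ M (by positivity) (inv_le_of_inv_le₀ hM h1)
    rwa [inv_inv] at this
  obtain ⟨M, hM, hHM⟩ : ∃ M : ℝ, 0 < M ∧ ∀ t, M ≤ t → 0 < H (t⁻¹ • e) := by
    have h1 : Filter.Tendsto (fun t : ℝ => H (t⁻¹ • e)) Filter.atTop (nhds (H 0)) := by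
      refine (hHc.tendsto 0).comp ?_
      simpa using (tendsto_inv_atTop_zero (𝕜 := ℝ)).smul_const e
    have h2 := h1.eventually (lt_mem_nhds (re_fourier_bumpSq_zero_pos (d := d)))
    obtain ⟨M, hM⟩ := Filter.eventually_atTop.1 (h2.and (Filter.eventually_gt_atTop 0))
    exact ⟨M, (hM M le_rfl).2, fun t ht => (hM t ht).1⟩
  -- One strict increment suffices: P(0) ≥ P(e/(M+1)) > P(e/M) ≥ 0.
  have hstrict : 0 < P ((M + 1)⁻¹ • e) - P (M⁻¹ • e) := by
    rw [hdiff M (M + 1) hM (by linarith)]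
    refine intervalIntegral.intervalIntegral_pos_of_pos_on ?_ (fun t ht => ?_) (by linarith)
    · refine ContinuousOn.intervalIntegrable ?_
      rw [Set.uIcc_of_le (by linarith)]
      have hinv : ContinuousOn (fun t : ℝ => t⁻¹) (Set.Icc M (M + 1)) :=
        continuousOn_inv₀.mono fun t ht => (hM.trans_le ht.1).ne'
      refine hinv.mul (ContinuousOn.mul ?_ (hHc.comp_continuousOn (hinv.smul continuousOn_const)))
      exact (continuousOn_const.mul (hinv.smul continuousOn_const).norm).rpow_const
        fun _ _ => Or.inr (by positivity)
    · have ht0 : 0 < t := hM.trans ht.1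
      have h1 := hHM t ht.1.le
      have h2 : 0 < ‖t⁻¹ • e‖ := by
        rw [norm_smul, hne, mul_one]; exact norm_pos_iff.2 (inv_ne_zero ht0.ne')
      exact mul_pos (inv_pos.2 ht0)
        (mul_pos (Real.rpow_pos_of_pos (mul_pos Real.two_pi_pos h2) _) h1)
  linarith [hupper (M + 1) (by linarith), hlower M hM]

end Profile

/-! ### The reproducing formula and the kernel estimates -/

section InteriorRegularity

variable {d : ℕ}

lemma WeightIntegrable.locallyIntegrable {δ : ℝ} {u : EuclideanSpace ℝ (Fin d) → ℝ}
    (hu : WeightIntegrable δ u) : LocallyIntegrable u := by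
  have h1 := (Integrable.locallyIntegrable hu).locallyIntegrableOn Set.univ
  have h2 := h1.mul_continuousOn (continuous_one_add_norm_rpow (d := d) (d + δ)).continuousOn
    isOpen_univ.isLocallyClosed
  rw [locallyIntegrableOn_univ] at h2
  refine h2.congr (Filter.Eventually.of_forall fun y => ?_)
  have : 0 < 1 + ‖y‖ := by positivity
  simp only
  rw [mul_assoc, ← Real.rpow_add this]
  simp

/-- The bump η(t(x - ·)) lives within distance 1/t ≤ R/2 of x, hence inside B_{2R}, so it is an
admissible test function. Homogeneity then removes the factor t^(2s). -/
lemma integral_mul_fracLap_bumpSq_eq_zero [NeZero d] {s : ℝ} (hs : 0 < s)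
    {u : EuclideanSpace ℝ (Fin d) → ℝ} {R : ℝ} (hR : 0 < R)
    (hu : IsFracHarmonicOn s u (Metric.ball 0 (2 * R))) {x : EuclideanSpace ℝ (Fin d)}
    (hx : ‖x‖ < 3 / 2 * R) {t : ℝ} (ht : 2 / R ≤ t) :
    ∫ y, u y * fracLap s (bumpSq d) (t • (x - y)) = 0 := by
  have ht0 : 0 < t := (by positivity : 0 < 2 / R).trans_le ht
  have hφ := (isTest_bumpSq (d := d)).comp_affine ht0 x
  have hsupp : tsupport (fun y => bumpSq d (t • (x - y))) ⊆ Metric.ball 0 (2 * R) := by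
    have h1 : tsupport (fun y => bumpSq d (t • (x - y))) ⊆ Metric.closedBall x (R / 2) := by
      refine closure_minimal (fun y hy => ?_) Metric.isClosed_closedBall
      by_contra hne
      refine hy (bumpSq_eq_zero ?_)
      rw [Metric.mem_closedBall, dist_comm, dist_eq_norm, not_le] at hne
      rw [norm_smul, Real.norm_of_nonneg ht0.le]
      rw [div_le_iff₀ hR] at ht
      nlinarith
    intro y hy
    have h2 := h1 hy
    rw [Metric.mem_closedBall, dist_eq_norm] at h2
    rw [mem_ball_zero_iff]
    have := norm_add_le (y - x) x
    rw [sub_add_cancel] at this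
    linarith
  have h := hu _ hφ.contDiff hφ.hasCompactSupport hsupp
  simp only [fracLaplacian_eq_ofReal hs hφ, fracLap_comp_affine hs isTest_bumpSq ht0,
    ← Complex.ofReal_mul] at h
  rw [integral_complex_ofReal, Complex.ofReal_eq_zero] at h
  simp only [mul_left_comm (u _)] at h
  rw [integral_const_mul, mul_eq_zero] at h
  exact h.resolve_left (by positivity)

/-- The reproducing kernel at scale `t` of `s`-harmonic functions. -/
noncomputable def reproKernel (d : ℕ) (s t : ℝ) (z : EuclideanSpace ℝ (Fin d)) : ℝ :=
  (∫ x, parametrix d s x)⁻¹ * t ^ d * parametrix d s (t • z)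

lemma smoothDecay_reproKernel [NeZero d] {s δ : ℝ} (hs : 0 < s) (hδ0 : 0 < δ) (hδ1 : δ < 1)
    (hδ : δ ≤ 2 * s) {t : ℝ} (ht : 0 < t) : SmoothDecay δ (reproKernel d s t) :=
  (smoothDecay_parametrix hs hδ0 hδ1 hδ).comp_smul hδ0 _ ht

/-- By telescoping, convolution with the dilated parametrix is the same at all scales N ≥ 2/R over
the ball of radius 3R/2, where 3/2 leaves room both for the bumps and for the closed ball of radius
R. Letting N → ∞ against a test function identifies it with (∫ρ) u. -/
lemma ae_eq_weightConv_reproKernel [NeZero d] {s δ : ℝ} (hs : 0 < s) (hδ0 : 0 < δ) (hδ1 : δ < 1)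
    (hδ : δ ≤ 2 * s) {u : EuclideanSpace ℝ (Fin d) → ℝ} (hui : WeightIntegrable δ u)
    {R : ℝ} (hR : 0 < R) (hu : IsFracHarmonicOn s u (Metric.ball 0 (2 * R))) :
    ∀ᵐ x, x ∈ Metric.ball (0 : EuclideanSpace ℝ (Fin d)) (3 / 2 * R) →
      u x = weightConv u (reproKernel d s (2 / R)) x := by
  have hρ := smoothDecay_parametrix (d := d) hs hδ0 hδ1 hδ
  have hθ : SmoothDecay δ (fracLap s (bumpSq d)) := smoothDecay_fracLap hs hδ isTest_bumpSq
  have hc := integral_parametrix_pos (d := d) hs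
  set c := ∫ x, parametrix d s x with hcdef
  have ht : 0 < 2 / R := by positivity
  have hK := smoothDecay_reproKernel (d := d) hs hδ0 hδ1 hδ ht
  set V := weightConv u (reproKernel d s (2 / R)) with hV
  have hVc : Continuous V := (contDiff_weightConv hδ0 hui hK).continuous
  have hscale : ∀ x ∈ Metric.ball (0 : EuclideanSpace ℝ (Fin d)) (3 / 2 * R), ∀ N, 2 / R ≤ N →
      ∫ y, u y * (N ^ d * parametrix d s (N • (x - y))) = c * V x := by
    intro x hx N hN
    rw [mem_ball_zero_iff] at hx
    have h1 := integral_mul_comp_smul_sub_diff hδ0 hui hθ hρ ht hN x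
    have h2 : ∫ t in (2 / R)..N, t ^ (d - 1) * ∫ y, u y * fracLap s (bumpSq d) (t • (x - y)) = 0 := by
      rw [← intervalIntegral.integral_zero (a := 2 / R) (b := N)]
      refine intervalIntegral.integral_congr fun t ht => ?_
      rw [Set.uIcc_of_le hN] at ht
      rw [integral_mul_fracLap_bumpSq_eq_zero hs hR hu hx ht.1, mul_zero]
    rw [h2, sub_eq_zero] at h1
    refine h1.trans ?_
    rw [hV, weightConv, ← integral_const_mul]
    congr 1 with y
    rw [reproKernel, ← hcdef, parametrix]
    field_simp
  have hloc : LocallyIntegrable fun x => c * u x - c * V x :=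
    (hui.locallyIntegrable.smul c).sub (hVc.const_smul c).locallyIntegrable
  have hae := Metric.isOpen_ball.ae_eq_zero_of_integral_contDiff_smul_eq_zero
    (hloc.locallyIntegrableOn (Metric.ball (0 : EuclideanSpace ℝ (Fin d)) (3 / 2 * R))) ?_
  · filter_upwards [hae] with x hx hxb
    have := hx hxb
    rw [← mul_sub, mul_eq_zero, sub_eq_zero] at this
    exact this.resolve_left hc.ne'
  intro g hg hgs hgU
  have hgt : IsTest g := ⟨hg, hgs⟩
  obtain ⟨C, -, hC⟩ := hρ.decay []
  have hlim := tendsto_integral_mul_integral_dilate hδ0 hui hgt hρ.contDiff.continuous hC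
  -- The approximating sequence is eventually constant, so its value is its limit.
  have hev : ∀ᶠ n : ℕ in Filter.atTop, ∫ x, g x * (c * V x) = ∫ x, g x *
        ∫ y, u y * (((n : ℝ) + 1) ^ d * parametrix d s (((n : ℝ) + 1) • (x - y))) := by
    filter_upwards [Filter.eventually_ge_atTop ⌈2 / R⌉₊] with n hn
    congr 1 with x
    by_cases hx : g x = 0
    · rw [hx, zero_mul, zero_mul]
    · rw [hscale x (hgU (subset_tsupport _ hx))]
      have := (Nat.le_ceil (2 / R)).trans (Nat.cast_le.2 hn)
      linarith
  have hconst := tendsto_nhds_unique hlim (tendsto_const_nhds.congr' hev)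
  have hi1 : Integrable fun x => g x * (c * V x) :=
    (hg.continuous.mul (hVc.const_smul c)).integrable_of_hasCompactSupport hgs.mul_right
  have hi2 : Integrable fun x => u x * (g x * c) := by
    exact hui.locallyIntegrable.integrable_smul_right_of_hasCompactSupport
      (hg.continuous.mul continuous_const) (hgs.mul_right (f' := fun _ => c))
  simp only [smul_eq_mul]
  have h3 : ∀ x, g x * (c * u x - c * V x) = u x * (g x * c) - g x * (c * V x) := fun x => by ring
  simp only [h3]
  rw [integral_sub hi2 hi1, hconst, sub_self]

/-- Dilation by t multiplies the height of the kernel by t^d, preserves its mass, and yields t for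
each derivative. Interpolating between height and mass for w in L^p gives t^(|l| + d/p). -/
lemma abs_integral_mul_reproKernel_le {s δ : ℝ} (hδ0 : 0 < δ)
    (hρ : SmoothDecay δ (parametrix d s)) (l : List (Fin d)) {M : ℝ}
    (hM : ∀ z, |iterPartial l (parametrix d s) z| ≤ M * (1 + ‖z‖) ^ (-(d + δ)))
    {t : ℝ} (ht : 0 < t) {p : ℝ} (hp : 1 ≤ p)
    {w : EuclideanSpace ℝ (Fin d) → ℝ} (hw : MemLp w (ENNReal.ofReal p) volume)
    (x : EuclideanSpace ℝ (Fin d)) :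
    |∫ y, w y * iterPartial l (reproKernel d s t) (x - y)| ≤
      |∫ x, parametrix d s x|⁻¹ * M * t ^ l.length *
      ((∫ z : EuclideanSpace ℝ (Fin d), (1 + ‖z‖) ^ (-(d + δ))) + 1) * (t ^ d) ^ (1 / p) *
      (eLpNorm w (ENNReal.ofReal p) volume).toReal := by
  have hM0 : 0 ≤ M := by have := (abs_nonneg _).trans (hM 0); simpa using this
  have heq : ∀ z, iterPartial l (reproKernel d s t) z = (∫ x, parametrix d s x)⁻¹ * t ^ d *
      t ^ l.length * iterPartial l (parametrix d s) (t • z) := fun z =>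
    congrFun (iterPartial_comp_smul hρ.contDiff _ t l) z
  have hle : ∀ z, |iterPartial l (reproKernel d s t) z| ≤
      |∫ x, parametrix d s x|⁻¹ * M * t ^ l.length * (t ^ d * (1 + ‖t • z‖) ^ (-(d + δ))) := by
    intro z
    rw [heq, abs_mul, abs_mul, abs_mul, abs_inv, abs_of_pos (by positivity : 0 < t ^ d),
      abs_of_pos (by positivity : 0 < t ^ l.length)]
    calc _ ≤ |∫ x, parametrix d s x|⁻¹ * t ^ d * t ^ l.length *
          (M * (1 + ‖t • z‖) ^ (-(d + δ))) := by gcongr; exact hM _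
      _ = _ := by ring
  have hcont : Continuous fun y => iterPartial l (reproKernel d s t) (x - y) := by
    have := (hρ.comp_smul hδ0 ((∫ x, parametrix d s x)⁻¹ * t ^ d) ht).contDiff.iterPartial l
    exact this.continuous.comp (by fun_prop)
  have hWi : Integrable fun y : EuclideanSpace ℝ (Fin d) =>
      t ^ d * (1 + ‖t • (x - y)‖) ^ (-(d + δ)) :=
    (((integrable_weight hδ0).comp_smul ht.ne').comp_sub_left x).const_mul _
  have hW : ∫ y : EuclideanSpace ℝ (Fin d), t ^ d * (1 + ‖t • (x - y)‖) ^ (-(d + δ)) =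
      ∫ z : EuclideanSpace ℝ (Fin d), (1 + ‖z‖) ^ (-(d + δ)) := by
    rw [integral_const_mul, integral_sub_left_eq_self
      (fun z : EuclideanSpace ℝ (Fin d) => (1 + ‖t • z‖) ^ (-(d + δ))) volume x,
      Measure.integral_comp_smul_of_nonneg volume
        (fun z : EuclideanSpace ℝ (Fin d) => (1 + ‖z‖) ^ (-(d + δ))) t (hR := ht.le),
      finrank_euclideanSpace_fin, smul_eq_mul, ← mul_assoc, mul_inv_cancel₀ (by positivity),
      one_mul]
  have hJi : Integrable fun y => iterPartial l (reproKernel d s t) (x - y) :=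
    (hWi.const_mul _).mono' hcont.aestronglyMeasurable (Filter.Eventually.of_forall fun y => hle _)
  refine abs_integral_mul_le_of_memLp hp hw (by positivity) hJi (fun y => ?_) ?_
  · refine (hle _).trans ?_
    gcongr
    refine mul_le_of_le_one_right (by positivity)
      (Real.rpow_le_one_of_one_le_of_nonpos (by linarith [norm_nonneg (t • (x - y))]) ?_)
    have : (0 : ℝ) ≤ d := Nat.cast_nonneg d
    linarith
  · rw [← hW, ← integral_const_mul]
    exact integral_mono hJi.abs (hWi.const_mul _) fun y => hle _

end InteriorRegularity

/-! ### The interior estimate -/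

/-- `u ∈ C^∞(closure B_R)` means that `u` agrees a.e. on the ball with (the restriction of) a
`C^∞` function `v` on `ℝ^d`; the values of `D^n v` on the closed ball do not depend on the choice
of `v`, and `D^n u` there means `D^n v`. The constant `C n` depends only on `d`, `s` and `n`. -/
theorem corollary3p2 (d : ℕ) (hd : 2 ≤ d) (s : ℝ) (hs0 : 0 < s) (hs : s < (d : ℝ) / 2) :
    ∃ C : (Fin d → ℕ) → ℝ, (∀ n, 0 < C n) ∧
      ∀ (k : ℕ) (p : Fin k → ℝ) (_hp : ∀ i, 1 ≤ p i)
        (w : Fin k → EuclideanSpace ℝ (Fin d) → ℝ)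
        (_hw : ∀ i, MemLp (w i) (ENNReal.ofReal (p i)) volume)
        (u : EuclideanSpace ℝ (Fin d) → ℝ)
        (_hu : u =ᵐ[volume] fun x => ∑ i, w i x)
        (R : ℝ) (_hR : 0 < R)
        (_hharm : IsFracHarmonicOn s u (Metric.ball 0 (2 * R))),
        ∃ v : EuclideanSpace ℝ (Fin d) → ℝ,
          ContDiff ℝ ∞ v ∧
          (∀ᵐ x ∂(volume.restrict (Metric.closedBall 0 R)), u x = v x) ∧
          ∀ (n : Fin d → ℕ), ∀ x ∈ Metric.closedBall (0 : EuclideanSpace ℝ (Fin d)) R,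
            |multiDeriv n v x| ≤
              C n * ∑ i, R ^ (-((∑ j, n j : ℕ) : ℝ) - (d : ℝ) / p i) *
                (eLpNorm (w i) (ENNReal.ofReal (p i)) volume).toReal := by
  have : NeZero d := ⟨by omega⟩
  obtain ⟨δ, hδ0, hδ1, hδ⟩ : ∃ δ : ℝ, 0 < δ ∧ δ < 1 ∧ δ ≤ 2 * s :=
    ⟨min s (1 / 2), by positivity, (min_le_right _ _).trans_lt (by norm_num),
      (min_le_left _ _).trans (by linarith)⟩
  have hρ := smoothDecay_parametrix (d := d) hs0 hδ0 hδ1 hδ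
  have hc := integral_parametrix_pos (d := d) hs0
  choose L hLlen hL using exists_list_multiDeriv_eq (d := d)
  choose M hM0 hM using fun n => hρ.decay (L n)
  set I := (∫ z : EuclideanSpace ℝ (Fin d), (1 + ‖z‖) ^ (-(d + δ))) + 1 with hI
  have hI0 : 0 < I := by
    have : 0 ≤ ∫ z : EuclideanSpace ℝ (Fin d), (1 + ‖z‖) ^ (-(d + δ)) :=
      integral_nonneg fun z => by positivity
    linarith
  -- `M n + 1` guarantees a positive constant. The power 2^(|n| + d) bounds the factor 2^(|n| + d/p)
  -- coming from the scale t = 2/R, uniformly in p ≥ 1.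
  refine ⟨fun n => |∫ x, parametrix d s x|⁻¹ * (M n + 1) * I * 2 ^ (∑ j, n j + d), fun n => ?_, ?_⟩
  · have := hM0 n
    have := abs_pos.2 hc.ne'
    positivity
  intro k p hp w hw u hu R hR hharm
  have hwi := fun i => WeightIntegrable.of_memLp hδ0 (hp i) (hw i)
  have hui : WeightIntegrable δ u := (WeightIntegrable.sum hwi).congr hu
  have ht : 0 < 2 / R := by positivity
  have hK := smoothDecay_reproKernel (d := d) hs0 hδ0 hδ1 hδ ht
  refine ⟨weightConv u (reproKernel d s (2 / R)), contDiff_weightConv hδ0 hui hK, ?_,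
    fun n x _ => ?_⟩
  -- The reproducing formula holds almost everywhere on the larger ball of radius 3R/2, which
  -- contains the closed ball of radius R.
  · rw [ae_restrict_iff' Metric.isClosed_closedBall.measurableSet]
    filter_upwards [ae_eq_weightConv_reproKernel hs0 hδ0 hδ1 hδ hui hR hharm] with x hx hxR
    refine hx (Metric.closedBall_subset_ball ?_ hxR)
    linarith
  · rw [hL, iterPartial_weightConv hδ0 hui hK, weightConv]
    obtain ⟨A, -, hA⟩ := (hK.iterPartial (L n)).decay []
    have hint : ∀ i, Integrable fun y => w i y * iterPartial (L n) (reproKernel d s (2 / R)) (x - y) := by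
      intro i
      refine (hwi i).integrable_mul (C := A * (1 + ‖x‖) ^ (d + δ))
        ((hK.iterPartial (L n)).contDiff.continuous.comp (by fun_prop)) fun y => ?_
      have hA0 : 0 ≤ A := by have := (abs_nonneg _).trans (hA 0); simpa using this
      rw [mul_assoc]
      refine (hA _).trans ?_
      gcongr
      exact weight_sub_le (by positivity) x y
    have hsum : ∫ y, u y * iterPartial (L n) (reproKernel d s (2 / R)) (x - y) =
        ∑ i, ∫ y, w i y * iterPartial (L n) (reproKernel d s (2 / R)) (x - y) := by
      rw [← integral_finsetSum _ fun i _ => hint i]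
      refine integral_congr_ae ?_
      filter_upwards [hu] with y hy
      rw [hy, Finset.sum_mul]
    rw [hsum, Finset.mul_sum]
    refine (Finset.abs_sum_le_sum_abs _ _).trans (Finset.sum_le_sum fun i _ => ?_)
    refine (abs_integral_mul_reproKernel_le hδ0 hρ (L n) (hM n) ht (hp i) (hw i) x).trans ?_
    rw [← hI, hLlen, ← mul_assoc]
    refine mul_le_mul_of_nonneg_right ?_ ENNReal.toReal_nonneg
    have hpi : 0 < p i := by linarith [hp i]
    have h1 : (2 / R) ^ (∑ j, n j) * ((2 / R) ^ d) ^ (1 / p i) ≤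
        2 ^ (∑ j, n j + d) * R ^ (-((∑ j, n j : ℕ) : ℝ) - (d : ℝ) / p i) := by
      rw [← Real.rpow_natCast (2 / R) d, ← Real.rpow_mul ht.le, mul_one_div,
        ← Real.rpow_natCast (2 / R), ← Real.rpow_add ht, Real.div_rpow zero_le_two hR.le,
        div_eq_mul_inv, ← Real.rpow_neg hR.le, neg_add, ← sub_eq_add_neg]
      gcongr
      rw [← Real.rpow_natCast]
      refine Real.rpow_le_rpow_of_exponent_le one_le_two ?_
      push_cast
      gcongr
      exact div_le_self (Nat.cast_nonneg d) (hp i)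
    have hMn := hM0 n
    calc _ = |∫ x, parametrix d s x|⁻¹ * M n * I *
          ((2 / R) ^ (∑ j, n j) * ((2 / R) ^ d) ^ (1 / p i)) := by ring
      _ ≤ |∫ x, parametrix d s x|⁻¹ * (M n + 1) * I *
          (2 ^ (∑ j, n j + d) * R ^ (-((∑ j, n j : ℕ) : ℝ) - (d : ℝ) / p i)) := by
          gcongr
          linarith
      _ = _ := by ring
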